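/- Let $A\in\mathbb{R}^{n\times n}$, $C\in\mathbb{R}^{m\times n}$, $E\in\mathbb{R}^{n\times q}$, $F\in\mathbb{R}^{m\times q}$, $G\in\mathbb{R}^{l\times n}$, $J\in\mathbb{R}^{l\times q}$ and $L\in\mathbb{R}^{n\times m}$, and consider the estimation error dynamics of the Luenberger observer with gain $L$, $$\dot e(t)=(A-LC)\,e(t)+(E-LF)\,w(t),\qquad z(t)=G\,e(t)+J\,w(t),\qquad t\ge 0,$$ with locally square-integrable inputs $w:[0,\infty)\to\mathbb{R}^q$ and solutions understood in the integral (Carathéodory) sense. Let $Q\in\mathbb{R}^{l\times l}$, $S\in\mathbb{R}^{l\times q}$, $R\in\mathbb{R}^{q\times q}$ with $-Q$ symmetric positive definite and $R=R^\top$. The system is called $(Q,S,R)$-dissipative from $w$ to $z$ if there is a continuous positive definite function $V:\mathbb{R}^n\to\mathbb{R}_{\ge0}$ (that is, $V(0)=0$ and $V(x)>0$ for $x\ne0$) such that, for all inputs $w$, all corresponding trajectories $e$ and all $t_1\ge t_0\ge 0$, $$V(e(t_1))-V(e(t_0))\le\int_{t_0}^{t_1}\begin{bmatrix}z(t)\\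 w(t)\end{bmatrix}^\top\begin{bmatrix}Q&S\\ S^\top&R\end{bmatrix}\begin{bmatrix}z(t)\\ w(t)\end{bmatrix}dt .$$ Then the error dynamics are $(Q,S,R)$-dissipative from $w$ to $z$ if and only if there exist a symmetric positive definite $P\in\mathbb{R}^{n\times n}$ and a matrix $K\in\mathbb{R}^{n\times m}$ such that $$\begin{bmatrix}-\mathcal{H}_s(PA-KC) & -PE+KF+G^\top S & G^\top\\ \star & \mathcal{H}_s(J^\top S)+R & J^\top\\ \star&\star&-Q^{-1}\end{bmatrix}\ge 0\qquad\text{and}\qquad L=P^{-1}K,$$ where $\mathcal{H}_s(M)=M+M^\top$, the symbol $\star$ denotes the blocks determined by symmetry, and $\ge 0$ means symmetric positive semidefinite. -/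

import Mathlib

open MeasureTheory

noncomputable section

/-- A continuous-time linear time-invariant system `ẋ = A x + B u`, `y = C x + D u`
with `n` states, `p` inputs and `m` outputs. -/
structure CTLTISystem (n p m : ℕ) where
  A : Matrix (Fin n) (Fin n) ℝ
  B : Matrix (Fin n) (Fin p) ℝ
  C : Matrix (Fin m) (Fin n) ℝ
  D : Matrix (Fin m) (Fin p) ℝ

namespace CTLTISystem

variable {n p m : ℕ}

/-- The output `y(t) = C x(t) + D u(t)`. -/
def output (sys : CTLTISystem n p m) (x : ℝ → Fin n → ℝ) (u : ℝ → Fin p → ℝ) (t : ℝ) :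
    Fin m → ℝ :=
  sys.C.mulVec (x t) + sys.D.mulVec (u t)

/-- `x` is a state trajectory on `[0, ∞)` for the input `u`. Inputs are locally
square-integrable on `[0, ∞)` (the extended space `L₂ₑ`), and `ẋ = A x + B u` is understood in the
usual (Carathéodory) sense, as an integral equation. -/
structure IsTrajectory (sys : CTLTISystem n p m) (x : ℝ → Fin n → ℝ) (u : ℝ → Fin p → ℝ) :
    Prop where
  input_memLp : ∀ T : ℝ, MemLp u 2 (volume.restrict (Set.Icc 0 T))
  state_continuousOn : ContinuousOn x (Set.Ici 0)
  state_eq : ∀ t : ℝ, 0 ≤ t →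
    x t = x 0 + ∫ s in (0 : ℝ)..t, (sys.A.mulVec (x s) + sys.B.mulVec (u s))

/-- The quadratic supply rate `[y; u]ᵀ [Q S; Sᵀ R] [y; u]`. -/
def supplyRate (Q : Matrix (Fin m) (Fin m) ℝ) (S : Matrix (Fin m) (Fin p) ℝ)
    (R : Matrix (Fin p) (Fin p) ℝ) (y : Fin m → ℝ) (u : Fin p → ℝ) : ℝ :=
  dotProduct (Sum.elim y u)
    ((Matrix.fromBlocks Q S S.transpose R).mulVec (Sum.elim y u))

/-- A (continuous) positive definite function on `ℝⁿ`. -/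
structure IsPosDefFun (V : (Fin n → ℝ) → ℝ) : Prop where
  continuous : Continuous V
  map_zero : V 0 = 0
  pos : ∀ x, x ≠ 0 → 0 < V x

/-- `(Q, S, R)`-dissipativity from the input `u` to the output `y`. The storage function need not
be quadratic. -/
def IsDissipative (sys : CTLTISystem n p m) (Q : Matrix (Fin m) (Fin m) ℝ)
    (S : Matrix (Fin m) (Fin p) ℝ) (R : Matrix (Fin p) (Fin p) ℝ) : Prop :=
  ∃ V : (Fin n → ℝ) → ℝ, IsPosDefFun V ∧
    ∀ (x : ℝ → Fin n → ℝ) (u : ℝ → Fin p → ℝ), sys.IsTrajectory x u →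
      ∀ t₀ t₁ : ℝ, 0 ≤ t₀ → t₀ ≤ t₁ →
        V (x t₁) - V (x t₀) ≤ ∫ t in t₀..t₁, supplyRate Q S R (sys.output x u t) (u t)

end CTLTISystem

/-- The estimation error dynamics `ė = (A - L C) e + (E - L F) w`, `z = G e + J w` of a Luenberger
observer with gain `L`, as a system from the noise `w` to the performance output `z`. -/
def luenbergerErrorSystem {n m q l : ℕ}
    (A : Matrix (Fin n) (Fin n) ℝ) (C : Matrix (Fin m) (Fin n) ℝ)
    (E : Matrix (Fin n) (Fin q) ℝ) (F : Matrix (Fin m) (Fin q) ℝ)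
    (G : Matrix (Fin l) (Fin n) ℝ) (J : Matrix (Fin l) (Fin q) ℝ)
    (L : Matrix (Fin n) (Fin m) ℝ) : CTLTISystem n q l where
  A := A - L * C
  B := E - L * F
  C := G
  D := J

/-- The symmetric part `Hₛ(M) = M + Mᵀ` (without the factor `1/2`). -/
def symPart {n : ℕ} (M : Matrix (Fin n) (Fin n) ℝ) : Matrix (Fin n) (Fin n) ℝ :=
  M + M.transpose

/-- The symmetric `3 × 3` block matrix
```
[ -Hₛ(P A - K C)   -P E + K F + Gᵀ S   Gᵀ   ]
[       ⋆             Hₛ(Jᵀ S) + R     Jᵀ   ]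
[       ⋆                  ⋆          -Q⁻¹  ]
``` -/
def dissipativeObserverLMI {n m q l : ℕ}
    (A : Matrix (Fin n) (Fin n) ℝ) (C : Matrix (Fin m) (Fin n) ℝ)
    (E : Matrix (Fin n) (Fin q) ℝ) (F : Matrix (Fin m) (Fin q) ℝ)
    (G : Matrix (Fin l) (Fin n) ℝ) (J : Matrix (Fin l) (Fin q) ℝ)
    (Q : Matrix (Fin l) (Fin l) ℝ) (S : Matrix (Fin l) (Fin q) ℝ)
    (R : Matrix (Fin q) (Fin q) ℝ)
    (P : Matrix (Fin n) (Fin n) ℝ) (K : Matrix (Fin n) (Fin m) ℝ) :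
    Matrix ((Fin n ⊕ Fin q) ⊕ Fin l) ((Fin n ⊕ Fin q) ⊕ Fin l) ℝ :=
  Matrix.fromBlocks
    (Matrix.fromBlocks
      (-symPart (P * A - K * C)) (-(P * E) + K * F + G.transpose * S)
      (-(P * E) + K * F + G.transpose * S).transpose (symPart (J.transpose * S) + R))
    (Matrix.fromRows G.transpose J.transpose)
    (Matrix.fromCols G J)
    (-Q⁻¹)

end

/-!
A Schur complement with respect to the block `-Q⁻¹` turns the matrix inequality into the pointwise
dissipation inequality `2 eᵀ P ė ≤ s(z, w)` for the supply rate `s`. Integrating it along the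
absolutely continuous function `eᵀ P e` shows that the matrix inequality is sufficient.

For necessity, a storage function `V` need not be quadratic, and the system need not be
controllable, so the usual available storage is a quadratic form that can be degenerate while the
required supply can be infinite. Three ideas repair this.

* Costs are quadratic in trajectories, so comparing `V` on a small ball and on the unit sphere and
  rescaling each trajectory shows that steering from `x` to `y` costs at least
  `c ‖y‖ ^ 2 - κ ‖x‖ ^ 2`. In particular the free motion is bounded, as it has nonpositive supply;
  an idempotent limit point `π` of its flow splits off a part on which the flow is bounded in
  backward time, the flow being contracting on the kernel of `π`.
* A disturbance acting on the kernel of `π` makes every state reachable from a bounded set of states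
  at bounded cost. If its supply is `2 P (x, d) + g ‖d‖ ^ 2` with `P` the available storage and `g`
  large, then a Lyapunov form on the kernel of `π` keeps the energy bound valid, with `c / 4` in
  place of `c`.
* For inputs which are constant on sampling intervals, the required supply in a prescribed number of
  steps is a quadratic form by the Jordan–von Neumann theorem. Averaging over the number of steps
  gives an approximate storage function, and letting the sampling period tend to zero gives a
  coercive quadratic one. Without the disturbance it is a storage function of the original system.
-/

section QuadraticEnvelope

variable {X : Type*} [AddCommGroup X]

open QuadraticMap in
theorem polar_add_left_of_parallelogram {W : X → ℝ}
    (hW : ∀ x y, W (x + y) + W (x - y) = 2 * W x + 2 * W y) (x x' y : X) :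
    polar W (x + x') y = polar W x y + polar W x' y := by
  have h₁ := hW (x + y) x'
  have h₂ := hW (x' + y) x
  have h₃ := hW y (x - x')
  have h₄ := hW x x'
  rw [show x + y + x' = x + x' + y by abel] at h₁
  rw [show x' + y + x = x + x' + y by abel] at h₂
  rw [show y + (x - x') = x + y - x' by abel, show y - (x - x') = x' + y - x by abel] at h₃
  simp only [polar]
  linarith

/-- A family of sets of real numbers indexed by a vector space which is compatible with scaling and
with one half of the parallelogram law. Its lower envelope is then a quadratic form. -/
structure IsQuadraticFamily [Module ℝ X] (R : X → Set ℝ) : Prop where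
  smul_mem : ∀ (t : ℝ) {x a}, a ∈ R x → t ^ 2 * a ∈ R (t • x)
  exists_add_le : ∀ {x y a b}, a ∈ R x → b ∈ R y →
    ∃ c ∈ R (x + y), ∃ d ∈ R (x - y), c + d ≤ 2 * a + 2 * b

end QuadraticEnvelope

section JordanVonNeumann

variable {X : Type*} [NormedAddCommGroup X] [NormedSpace ℝ X]

open QuadraticMap in
theorem polar_smul_left_of_parallelogram {W : X → ℝ} {C : ℝ} (hC : ∀ x, |W x| ≤ C * ‖x‖ ^ 2)
    (hW : ∀ x y, W (x + y) + W (x - y) = 2 * W x + 2 * W y) (t : ℝ) (x y : X) :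
    polar W (t • x) y = t * polar W x y := by
  let f : X →+ ℝ :=
    AddMonoidHom.mk' (fun x => polar W x y) fun a b => polar_add_left_of_parallelogram hW a b y
  have hf : Continuous f := by
    refine f.continuous_of_isBounded_nhds_zero (Metric.ball_mem_nhds 0 one_pos) ?_
    refine (Metric.isBounded_closedBall (x := (0 : ℝ))
      (r := |C| * (1 + ‖y‖) ^ 2 + |C| * 1 ^ 2 + |C| * ‖y‖ ^ 2)).subset ?_
    rintro _ ⟨x, hx, rfl⟩
    have hx : ‖x‖ ≤ 1 := (mem_ball_zero_iff.1 hx).le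
    have hbound : ∀ z r, ‖z‖ ≤ r → |W z| ≤ |C| * r ^ 2 := fun z r hz => (hC z).trans <| by
      gcongr; exact le_abs_self C
    have hxy := abs_le.1 <| hbound (x + y) (1 + ‖y‖) (norm_add_le_of_le hx le_rfl)
    have hx := abs_le.1 <| hbound x 1 hx
    have hy := abs_le.1 <| hbound y ‖y‖ le_rfl
    rw [mem_closedBall_zero_iff, Real.norm_eq_abs, abs_le]
    constructor <;> simp only [f, AddMonoidHom.mk'_apply, polar] <;> linarith
  exact map_real_smul f hf t x

variable [FiniteDimensional ℝ X]

theorem exists_form_of_parallelogram_le {W : X → ℝ} {C : ℝ}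
    (hC : ∀ x, |W x| ≤ C * ‖x‖ ^ 2) (hs : ∀ (t : ℝ) x, W (t • x) = t ^ 2 * W x)
    (hW : ∀ x y, W (x + y) + W (x - y) ≤ 2 * W x + 2 * W y) :
    ∃ B : X →L[ℝ] X →L[ℝ] ℝ, (∀ x y, B x y = B y x) ∧ ∀ x, B x x = W x := by
  -- Applied to `x + y` and `x - y`, the inequality becomes its own converse.
  have hWeq : ∀ x y, W (x + y) + W (x - y) = 2 * W x + 2 * W y := fun x y => by
    have h := hW (x + y) (x - y)
    rw [show x + y + (x - y) = (2 : ℝ) • x by module,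
      show x + y - (x - y) = (2 : ℝ) • y by module, hs, hs] at h
    linarith [hW x y]
  let q : QuadraticForm ℝ X := .ofPolar W (fun t x => by rw [hs, sq, smul_eq_mul])
    (polar_add_left_of_parallelogram hWeq) (polar_smul_left_of_parallelogram hC hWeq)
  refine ⟨(QuadraticMap.associated (R := ℝ) q).toContinuousBilinearMap, fun x y => ?_, fun x => ?_⟩
  · exact QuadraticMap.associated_isSymm ℝ q x y
  · exact QuadraticMap.associated_eq_self_apply ℝ q x

theorem IsQuadraticFamily.exists_isGLB {R : X → Set ℝ} (hR : IsQuadraticFamily R) {C : ℝ}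
    (hlow : ∀ x, ∀ a ∈ R x, -(C * ‖x‖ ^ 2) ≤ a) (hup : ∀ x, ∃ a ∈ R x, a ≤ C * ‖x‖ ^ 2) :
    ∃ B : X →L[ℝ] X →L[ℝ] ℝ, (∀ x y, B x y = B y x) ∧ ∀ x, IsGLB (R x) (B x x) := by
  have hne : ∀ x, (R x).Nonempty := fun x => (hup x).imp fun _ => And.left
  have hglb : ∀ x, IsGLB (R x) (sInf (R x)) := fun x => isGLB_csInf (hne x) ⟨_, hlow x⟩
  have hle : ∀ {t : ℝ}, t ≠ 0 → ∀ x, sInf (R (t • x)) ≤ t ^ 2 * sInf (R x) := fun {t} ht x => by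
    have ht : 0 < t ^ 2 := by positivity
    rw [← div_le_iff₀' ht]
    exact le_csInf (hne x) fun a ha => (div_le_iff₀' ht).2 <| (hglb _).1 <| hR.smul_mem t ha
  have hbound : ∀ x, |sInf (R x)| ≤ C * ‖x‖ ^ 2 := fun x => by
    obtain ⟨a, ha, hle⟩ := hup x
    exact abs_le.2 ⟨le_csInf (hne x) (hlow x), ((hglb x).1 ha).trans hle⟩
  have hsmul : ∀ (t : ℝ) x, sInf (R (t • x)) = t ^ 2 * sInf (R x) := fun t x => by
    rcases eq_or_ne t 0 with rfl | ht
    · simpa using hbound 0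
    refine (hle ht x).antisymm ?_
    have h := hle (inv_ne_zero ht) (t • x)
    rwa [inv_smul_smul₀ ht, inv_pow, ← div_eq_inv_mul, le_div_iff₀' (by positivity)] at h
  have hadd : ∀ x y, sInf (R (x + y)) + sInf (R (x - y)) ≤ 2 * sInf (R x) + 2 * sInf (R y) := by
    intro x y
    set s := sInf (R (x + y)) + sInf (R (x - y))
    have hab : ∀ a ∈ R x, ∀ b ∈ R y, s / 2 - a ≤ b := fun a ha b hb => by
      obtain ⟨c, hc, d, hd, h⟩ := hR.exists_add_le ha hb
      linarith [(hglb _).1 hc, (hglb _).1 hd]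
    have ha : ∀ a ∈ R x, s / 2 - sInf (R y) ≤ a := fun a ha => by
      linarith [le_csInf (hne y) (hab a ha)]
    linarith [le_csInf (hne x) ha]
  obtain ⟨B, hB, hBx⟩ := exists_form_of_parallelogram_le hbound hsmul hadd
  exact ⟨B, hB, fun x => hBx x ▸ hglb x⟩

end JordanVonNeumann

/-- `Reach φ q N x y a`: the discrete-time system `x⁺ = φ (x, u)` can be steered from `x` to `y` in
`N` steps at the total cost `a`, where a single step costs `q (x, u)`. -/
inductive Reach {X U : Type*} (φ : X × U → X) (q : X × U → ℝ) : ℕ → X → X → ℝ → Prop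
  | refl (x : X) : Reach φ q 0 x x 0
  | step {N : ℕ} {x y : X} {a : ℝ} (u : U) :
      Reach φ q N x y a → Reach φ q (N + 1) x (φ (y, u)) (a + q (y, u))

namespace Reach

section

variable {X U : Type*} {φ : X × U → X} {q : X × U → ℝ} {N : ℕ} {x y : X} {a : ℝ}

theorem cast {y' : X} {a' : ℝ} (h : Reach φ q N x y a) (hy : y = y') (ha : a = a') :
    Reach φ q N x y' a' := hy ▸ ha ▸ h

theorem single (x : X) (u : U) : Reach φ q 1 x (φ (x, u)) (q (x, u)) :=
  ((refl x).step u).cast rfl (zero_add _)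

theorem trans {M : ℕ} {w : X} {b : ℝ} (h : Reach φ q N x y a) (h' : Reach φ q M y w b) :
    Reach φ q (N + M) x w (a + b) := by
  induction h' with
  | refl => exact h.cast rfl (add_zero a).symm
  | step u _ ih => exact ((ih h).step u).cast rfl (add_assoc _ _ _)

theorem sub_le {V : X → ℝ} (hV : ∀ z, V (φ z) - V z.1 ≤ q z) (h : Reach φ q N x y a) :
    V y - V x ≤ a := by
  induction h with
  | refl x => simp
  | @step _ _ y _ u _ ih => linarith [hV (y, u)]

end

variable {X U : Type*} [NormedAddCommGroup X] [NormedSpace ℝ X] [NormedAddCommGroup U]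
  [NormedSpace ℝ U] {φ : X × U →L[ℝ] X} {Q : X × U →L[ℝ] X × U →L[ℝ] ℝ} {N : ℕ} {x y : X} {a : ℝ}

theorem smul (t : ℝ) (h : Reach φ (fun z => Q z z) N x y a) :
    Reach φ (fun z => Q z z) N (t • x) (t • y) (t ^ 2 * a) := by
  induction h with
  | refl x => exact (refl _).cast rfl (by simp)
  | @step N x y a u _ ih =>
    refine (ih.step (t • u)).cast ?_ ?_
    · rw [← φ.map_smul, Prod.smul_mk]
    · simp only [← Prod.smul_mk, map_smul, smul_apply, smul_eq_mul]
      ring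

theorem parallelogram (h : Reach φ (fun z => Q z z) N x y a) {x' y' : X} {a' : ℝ}
    (h' : Reach φ (fun z => Q z z) N x' y' a') :
    ∃ c d, Reach φ (fun z => Q z z) N (x + x') (y + y') c ∧
      Reach φ (fun z => Q z z) N (x - x') (y - y') d ∧ c + d = 2 * a + 2 * a' := by
  induction h generalizing x' y' a' with
  | refl x =>
    cases h'
    exact ⟨0, 0, refl _, refl _, by simp⟩
  | @step N x y a u _ ih =>
    cases h' with
    | @step _ _ y' a' u' h' =>
      obtain ⟨c, d, hc, hd, hcd⟩ := ih h'
      refine ⟨_, _, (hc.step (u + u')).cast ?_ rfl, (hd.step (u - u')).cast ?_ rfl, ?_⟩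
      · rw [← φ.map_add, Prod.mk_add_mk]
      · rw [← φ.map_sub, Prod.mk_sub_mk]
      · simp only [← Prod.mk_add_mk, ← Prod.mk_sub_mk, map_add, map_sub, add_apply,
          sub_apply]
        linarith

theorem exists_extend (hQ : ∀ x, Q (x, 0) (x, 0) ≤ 0) (h : Reach φ (fun z => Q z z) N x y a)
    (k : ℕ) : ∃ y' a', Reach φ (fun z => Q z z) (N + k) x y' a' ∧ a' ≤ a := by
  induction k with
  | zero => exact ⟨y, a, h, le_rfl⟩
  | succ k ih =>
    obtain ⟨y', a', h', ha'⟩ := ih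
    exact ⟨_, _, h'.step 0, by linarith [hQ y']⟩

end Reach

section Flow

open NormedSpace

variable {X : Type*} [NormedAddCommGroup X] [NormedSpace ℝ X]

/-- The flow `t ↦ exp (t A)` of the linear differential equation `ẋ = A x`. -/
noncomputable def linFlow (A : X →L[ℝ] X) (t : ℝ) : X →L[ℝ] X := exp (t • A)

theorem linFlow_zero (A : X →L[ℝ] X) : linFlow A 0 = 1 := by
  rw [linFlow, zero_smul, exp_zero]

theorem linFlow_apply_gen (A : X →L[ℝ] X) (t : ℝ) (x : X) : linFlow A t (A x) = A (linFlow A t x) :=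
  DFunLike.congr_fun (((Commute.refl A).smul_left t).exp_left : Commute (linFlow A t) A) x

variable [CompleteSpace X] (A : X →L[ℝ] X)

theorem linFlow_add (s t : ℝ) : linFlow A (s + t) = linFlow A s * linFlow A t := by
  have : NormedAlgebra ℚ (X →L[ℝ] X) := NormedAlgebra.restrictScalars ℚ ℝ _
  rw [linFlow, add_smul, exp_add_of_commute ((Commute.refl A).smul_left s |>.smul_right t)]
  rfl

theorem linFlow_add_apply (s t : ℝ) (x : X) :
    linFlow A (s + t) x = linFlow A s (linFlow A t x) := by
  rw [linFlow_add, mul_apply_eq_comp]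

theorem linFlow_mul_linFlow_neg (t : ℝ) : linFlow A t * linFlow A (-t) = 1 := by
  rw [← linFlow_add, add_neg_cancel, linFlow_zero]

theorem linFlow_comm (s t : ℝ) : linFlow A s * linFlow A t = linFlow A t * linFlow A s := by
  rw [← linFlow_add, add_comm, linFlow_add]

theorem hasDerivAt_linFlow (t : ℝ) : HasDerivAt (linFlow A) (A * linFlow A t) t :=
  hasDerivAt_exp_smul_const' A t

theorem hasDerivAt_linFlow_apply (x : X) (t : ℝ) :
    HasDerivAt (fun t => linFlow A t x) (A (linFlow A t x)) t :=
  (ContinuousLinearMap.apply ℝ X x).hasFDerivAt.comp_hasDerivAt t (hasDerivAt_linFlow A t)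

theorem continuous_linFlow : Continuous (linFlow A) :=
  continuous_iff_continuousAt.2 fun t => (hasDerivAt_linFlow A t).continuousAt

variable {A} in
theorem eq_linFlow_of_hasDerivAt {x : ℝ → X} (hx : ∀ t, HasDerivAt x (A (x t)) t) (t : ℝ) :
    x t = linFlow A t (x 0) := by
  refine congrFun (ODE_solution_unique_univ (v := fun _ => A) (s := fun _ => Set.univ)
    (K := ‖A‖₊) (t₀ := 0) (fun _ => A.lipschitz.lipschitzOnWith) (fun t => ⟨hx t, trivial⟩)
    (fun t => ⟨hasDerivAt_linFlow_apply A (x 0) t, trivial⟩) ?_) t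
  rw [linFlow_zero, one_apply_eq_self]

end Flow

section Form

variable {X : Type*} [NormedAddCommGroup X] [NormedSpace ℝ X] {Q : X →L[ℝ] X →L[ℝ] ℝ}

theorem hasDerivAt_form_apply_self (hQ : ∀ x y, Q x y = Q y x) {x : ℝ → X} {x' : X} {t : ℝ}
    (hx : HasDerivAt x x' t) : HasDerivAt (fun t => Q (x t) (x t)) (2 * Q (x t) x') t := by
  have h := (Q.hasFDerivAt.comp_hasDerivAt t hx).clm_apply hx
  refine h.congr_deriv ?_
  simp only [Function.comp_apply]
  rw [hQ x', two_mul]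

theorem form_sub_self_le (hQ : ∀ x, 0 ≤ Q x x) (x y : X) :
    Q (x - y) (x - y) ≤ 2 * Q x x + 2 * Q y y := by
  have := hQ (x + y)
  simp only [map_add, map_sub, add_apply, sub_apply] at this ⊢
  linarith

end Form

section Gramian

variable {X : Type*} [NormedAddCommGroup X] [NormedSpace ℝ X]

/-- The form `∫₀ᵗ F(s)ᵀ Q F(s) ds` obtained by integrating `Q` along the flow `F` of `A`. -/
noncomputable def gramian (A : X →L[ℝ] X) (Q : X →L[ℝ] X →L[ℝ] ℝ) (t : ℝ) : X →L[ℝ] X →L[ℝ] ℝ :=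
  ∫ s in (0 : ℝ)..t, Q.bilinearComp (linFlow A s) (linFlow A s)

theorem gramian_zero (A : X →L[ℝ] X) (Q : X →L[ℝ] X →L[ℝ] ℝ) : gramian A Q 0 = 0 :=
  intervalIntegral.integral_same

variable [CompleteSpace X] (A : X →L[ℝ] X) (Q : X →L[ℝ] X →L[ℝ] ℝ)

theorem continuous_form_linFlow (x y : X) :
    Continuous fun s => Q (linFlow A s x) (linFlow A s y) := by
  have := continuous_linFlow A
  fun_prop

theorem gramian_apply (t : ℝ) (x y : X) :
    gramian A Q t x y = ∫ s in (0 : ℝ)..t, Q (linFlow A s x) (linFlow A s y) := by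
  have hF := continuous_linFlow A
  have hcont : Continuous fun s => Q.bilinearComp (linFlow A s) (linFlow A s) := by
    have hflip := (ContinuousLinearMap.flipₗᵢ ℝ X X ℝ).continuous
    exact hflip.comp <| .clm_comp (hflip.comp <| continuous_const.clm_comp hF) hF
  rw [gramian, ContinuousLinearMap.intervalIntegral_apply (hcont.intervalIntegrable _ _),
    ContinuousLinearMap.intervalIntegral_apply
      ((hcont.clm_apply continuous_const).intervalIntegrable _ _)]
  rfl

theorem hasDerivAt_gramian_apply (x y : X) (t : ℝ) :
    HasDerivAt (fun t => gramian A Q t x y) (Q (linFlow A t x) (linFlow A t y)) t := by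
  simp only [gramian_apply]
  exact (continuous_form_linFlow A Q x y).integral_hasStrictDerivAt 0 t |>.hasDerivAt

theorem gramian_add (s t : ℝ) (x : X) :
    gramian A Q (s + t) x x =
      gramian A Q s x x + gramian A Q t (linFlow A s x) (linFlow A s x) := by
  have hcont := continuous_form_linFlow A Q x x
  simp only [gramian_apply, ← linFlow_add_apply]
  rw [intervalIntegral.integral_comp_add_right
      (fun r => Q (linFlow A r x) (linFlow A r x)), zero_add, add_comm t s,
    intervalIntegral.integral_add_adjacent_intervals (hcont.intervalIntegrable _ _)
      (hcont.intervalIntegrable _ _)]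

variable {A Q}

theorem sub_le_gramian {f f' : ℝ → ℝ} {x : X} {h : ℝ} (hh : 0 ≤ h)
    (hf : ∀ t, HasDerivAt f (f' t) t) (hle : ∀ t, f' t ≤ Q (linFlow A t x) (linFlow A t x)) :
    f h - f 0 ≤ gramian A Q h x x := by
  have hmono : Monotone fun t => gramian A Q t x x - f t :=
    monotone_of_hasDerivAt_nonneg (fun t => (hasDerivAt_gramian_apply A Q x x t).sub (hf t))
      fun t => sub_nonneg.2 (hle t)
  have := hmono hh
  simp only [gramian_zero, zero_apply] at this
  linarith

theorem gramian_comm (hQ : ∀ x y, Q x y = Q y x) (t : ℝ) (x y : X) :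
    gramian A Q t x y = gramian A Q t y x := by
  simp only [gramian_apply, hQ (linFlow A _ x)]

theorem two_mul_gramian_apply_gen (hQ : ∀ x y, Q x y = Q y x) (t : ℝ) (x : X) :
    2 * gramian A Q t x (A x) = Q (linFlow A t x) (linFlow A t x) - Q x x := by
  have hderiv := fun s (_ : s ∈ Set.uIcc 0 t) =>
    hasDerivAt_form_apply_self hQ (hasDerivAt_linFlow_apply A x s)
  have hFTC := intervalIntegral.integral_eq_sub_of_hasDerivAt hderiv <| by
    simp only [← linFlow_apply_gen]
    exact ((continuous_form_linFlow A Q x (A x)).const_mul 2).intervalIntegrable _ _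
  rw [linFlow_zero, one_apply_eq_self] at hFTC
  rw [gramian_apply, ← hFTC, intervalIntegral.integral_const_mul]
  simp only [linFlow_apply_gen]

end Gramian

section SampledFlow

variable {X U : Type*} [NormedAddCommGroup X] [NormedSpace ℝ X] [NormedAddCommGroup U]
  [NormedSpace ℝ U]

/-- The generator `(x, u) ↦ (A x + B u, 0)` of the motion of a state together with a constant
input. -/
def inputGen (A : X →L[ℝ] X) (B : U →L[ℝ] X) : X × U →L[ℝ] X × U :=
  (A.coprod B).prod 0

/-- The state reached by `ẋ = A x + B u` at time `t`, as a function of the initial state and of the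
constant input. -/
noncomputable def sampledFlow (A : X →L[ℝ] X) (B : U →L[ℝ] X) (t : ℝ) : X × U →L[ℝ] X :=
  .comp (.fst ℝ X U) (linFlow (inputGen A B) t)

theorem inputGen_apply (A : X →L[ℝ] X) (B : U →L[ℝ] X) (z : X × U) :
    inputGen A B z = (A z.1 + B z.2, 0) := rfl

theorem sampledFlow_zero (A : X →L[ℝ] X) (B : U →L[ℝ] X) (z : X × U) :
    sampledFlow A B 0 z = z.1 := by
  simp [sampledFlow, linFlow_zero]

variable [CompleteSpace X] [CompleteSpace U] {A : X →L[ℝ] X} {B : U →L[ℝ] X}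

theorem linFlow_inputGen (t : ℝ) (z : X × U) :
    linFlow (inputGen A B) t z = (sampledFlow A B t z, z.2) := by
  refine Prod.ext rfl ?_
  have hderiv : ∀ t, HasDerivAt (fun t => (linFlow (inputGen A B) t z).2) 0 t := fun t =>
    (hasDerivAt_linFlow_apply _ z t).snd
  have hconst := is_const_of_deriv_eq_zero (fun t => (hderiv t).differentiableAt)
    (fun t => (hderiv t).deriv) t 0
  simpa [linFlow_zero] using hconst

theorem hasDerivAt_sampledFlow (z : X × U) (t : ℝ) :
    HasDerivAt (fun t => sampledFlow A B t z) (A (sampledFlow A B t z) + B z.2) t := by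
  have h := (hasDerivAt_linFlow_apply (inputGen A B) z t).fst
  rwa [linFlow_inputGen, inputGen_apply] at h

theorem eq_sampledFlow_of_hasDerivAt {x : ℝ → X} {u : U}
    (hx : ∀ t, HasDerivAt x (A (x t) + B u) t) (t : ℝ) : x t = sampledFlow A B t (x 0, u) := by
  have h := eq_linFlow_of_hasDerivAt (A := inputGen A B) (x := fun t => (x t, u))
    (fun t => (hx t).prodMk (hasDerivAt_const t u)) t
  exact congrArg Prod.fst h

theorem sampledFlow_coprod {U' : Type*} [NormedAddCommGroup U'] [NormedSpace ℝ U']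
    [CompleteSpace U'] {B' : U' →L[ℝ] X} (t : ℝ) (x y : X) (u : U) (u' : U') :
    sampledFlow A (B.coprod B') t (x + y, (u, u')) =
      sampledFlow A B t (x, u) + sampledFlow A B' t (y, u') := by
  have h := eq_sampledFlow_of_hasDerivAt (A := A) (B := B.coprod B') (u := (u, u'))
    (x := fun t => sampledFlow A B t (x, u) + sampledFlow A B' t (y, u')) (fun t =>
      ((hasDerivAt_sampledFlow _ t).add (hasDerivAt_sampledFlow _ t)).congr_deriv <| by
        simp only [map_add, ContinuousLinearMap.coprod_apply]
        abel) t
  simpa only [sampledFlow_zero] using h.symm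

theorem sampledFlow_zero_input (t : ℝ) (x : X) : sampledFlow A B t (x, 0) = linFlow A t x := by
  have h := eq_sampledFlow_of_hasDerivAt (A := A) (B := B) (u := 0) (x := fun t => linFlow A t x)
    (fun t => (hasDerivAt_linFlow_apply A x t).congr_deriv (by simp)) t
  rw [h, linFlow_zero, one_apply_eq_self]

/-- Sampled trajectories: the system `ẋ = A x + B u` can be steered from `x` to `y` by an input
which is constant on each of `N` consecutive intervals of length `h`, while the integral of
`Q (x, u) (x, u)` equals `a`. -/
abbrev SampledReach (A : X →L[ℝ] X) (B : U →L[ℝ] X) (Q : X × U →L[ℝ] X × U →L[ℝ] ℝ) (h : ℝ) :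
    ℕ → X → X → ℝ → Prop :=
  Reach (sampledFlow A B h) fun z => gramian (inputGen A B) Q h z z

variable (A B) in
theorem sampledReach_const (Q : X × U →L[ℝ] X × U →L[ℝ] ℝ) (h : ℝ) (k : ℕ) (z : X × U) :
    SampledReach A B Q h k z.1 (sampledFlow A B (k * h) z)
      (gramian (inputGen A B) Q (k * h) z z) := by
  induction k with
  | zero =>
    refine (Reach.refl z.1).cast ?_ ?_
    · rw [Nat.cast_zero, zero_mul, sampledFlow_zero]
    · rw [Nat.cast_zero, zero_mul, gramian_zero, zero_apply, zero_apply]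
  | succ k ih =>
    have hz := linFlow_inputGen (A := A) (B := B) (k * h) z
    refine (ih.step z.2).cast ?_ ?_
    · rw [← hz, sampledFlow, ContinuousLinearMap.comp_apply, ← linFlow_add_apply, sampledFlow,
        ContinuousLinearMap.comp_apply]
      congr 3
      push_cast
      ring
    · rw [← hz, ← gramian_add]
      congr 3
      push_cast
      ring

end SampledFlow

section CenterProjection

open Filter Topology

variable {X : Type*} [NormedAddCommGroup X] [NormedSpace ℝ X]

/-- A projection which splits `ẋ = A x` into two parts: on the range of `π` the flow is bounded in
backward time, and on its kernel the flow is eventually a contraction. For a matrix with bounded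
forward flow this is the spectral projection onto the imaginary axis. -/
structure IsCenterProjection (A π : X →L[ℝ] X) : Prop where
  mul_self : π * π = π
  linFlow_mul : ∀ t, linFlow A t * π = π * linFlow A t
  exists_bound : ∃ M, ∀ t, 0 ≤ t → ‖linFlow A (-t) * π‖ ≤ M
  exists_contraction : ∃ τ > 0, ‖linFlow A τ * (1 - π)‖ < 1

variable {A : X →L[ℝ] X}

theorem exists_idempotent_mapClusterPt_linFlow [FiniteDimensional ℝ X] {M : ℝ}
    (hM : ∀ t, 0 ≤ t → ‖linFlow A t‖ ≤ M) :
    ∃ π : X →L[ℝ] X, MapClusterPt π atTop (linFlow A) ∧ π * π = π := by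
  have hball : ∀ᶠ t in atTop, linFlow A t ∈ Metric.closedBall 0 M :=
    (eventually_ge_atTop 0).mono fun t ht => mem_closedBall_zero_iff.2 (hM t ht)
  have hcompact : IsCompact (Metric.closedBall (0 : X →L[ℝ] X) M) := isCompact_closedBall 0 M
  refine exists_idempotent_in_compact_subsemigroup (s := {π | MapClusterPt π atTop (linFlow A)})
    (fun π => continuous_mul_const π) ?_ ?_ fun π hπ π' hπ' => ?_
  · exact (hcompact.exists_mapClusterPt (tendsto_principal.2 hball)).imp fun _ => And.right
  · exact hcompact.of_isClosed_subset isClosed_setOfPred_clusterPt fun π hπ =>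
      Metric.isClosed_closedBall.mem_of_mapClusterPt hπ hball
  · have hmul := (hπ.prodMap hπ').tendsto_comp
      (continuous_mul.tendsto ((π, π') : (X →L[ℝ] X) × (X →L[ℝ] X)))
    refine MapClusterPt.of_comp (φ := fun p : ℝ × ℝ => p.1 + p.2) ?_ (hmul.congrFun ?_)
    · exact tendsto_fst.atTop_add_atTop tendsto_snd
    · exact .of_forall fun p => (linFlow_add A p.1 p.2).symm

theorem exists_isCenterProjection [FiniteDimensional ℝ X] {M : ℝ}
    (hM : ∀ t, 0 ≤ t → ‖linFlow A t‖ ≤ M) : ∃ π, IsCenterProjection A π := by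
  obtain ⟨π, hπ, hidem⟩ := exists_idempotent_mapClusterPt_linFlow hM
  refine ⟨π, hidem, fun t => ?_, ⟨M, fun t _ => ?_⟩, ?_⟩
  · exact (isClosed_eq (continuous_const_mul _) (continuous_mul_const _)).mem_of_mapClusterPt hπ
      (.of_forall fun s => linFlow_comm A t s)
  · have hclosed : IsClosed {S : X →L[ℝ] X | ‖linFlow A (-t) * S‖ ≤ M} :=
      isClosed_le (continuous_const_mul _).norm continuous_const
    refine hclosed.mem_of_mapClusterPt hπ ?_
    filter_upwards [eventually_ge_atTop t] with s hs
    rw [← linFlow_add]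
    exact hM _ (by linarith)
  · have hsmall : ∀ᶠ S in 𝓝 π, ‖S * (1 - π)‖ < 1 := by
      refine (continuous_mul_const (1 - π)).norm.tendsto π |>.eventually_lt_const ?_
      rw [mul_sub, mul_one, hidem, sub_self, norm_zero]
      exact one_pos
    obtain ⟨τ, hτ, hτpos⟩ := ((hπ.frequently hsmall).and_eventually (eventually_gt_atTop 0)).exists
    exact ⟨τ, hτpos, hτ⟩

theorem IsCenterProjection.apply_gen [CompleteSpace X] {π : X →L[ℝ] X}
    (hπ : IsCenterProjection A π) (x : X) : π (A x) = A (π x) := by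
  have hπA := π.hasFDerivAt.comp_hasDerivAt (0 : ℝ) (hasDerivAt_linFlow_apply A x 0)
  have hAπ := hasDerivAt_linFlow_apply A (π x) 0
  have hcomm : (fun t => linFlow A t (π x)) = fun t => π (linFlow A t x) :=
    funext fun t => DFunLike.congr_fun (hπ.linFlow_mul t) x
  rw [hcomm] at hAπ
  simpa only [linFlow_zero, one_apply_eq_self] using hπA.unique hAπ

end CenterProjection

section StorageForm

open Filter Topology

variable {X U : Type*} [NormedAddCommGroup X] [NormedSpace ℝ X] [NormedAddCommGroup U]
  [NormedSpace ℝ U]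

/-- `P` is a quadratic storage function of `ẋ = A x + B u` for the supply rate `Q`: the derivative
of `P (x, x)` along the system does not exceed `Q ((x, u), (x, u))`. -/
structure IsStorageForm (A : X →L[ℝ] X) (B : U →L[ℝ] X) (Q : X × U →L[ℝ] X × U →L[ℝ] ℝ)
    (P : X →L[ℝ] X →L[ℝ] ℝ) : Prop where
  symm : ∀ x y, P x y = P y x
  dissipation : ∀ x u, 2 * P x (A x + B u) ≤ Q (x, u) (x, u)

theorem norm_form_le {P : X →L[ℝ] X →L[ℝ] ℝ} (hP : ∀ x y, P x y = P y x) (hnonneg : ∀ x, 0 ≤ P x x)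
    {C : ℝ} (hC : ∀ x, P x x ≤ C * ‖x‖ ^ 2) : ‖P‖ ≤ |C| := by
  have hle : ∀ x, P x x ≤ |C| * ‖x‖ ^ 2 := fun x => (hC x).trans <| by
    gcongr; exact le_abs_self C
  refine P.opNorm_le_bound₂ (abs_nonneg C) fun x y => abs_le_of_sq_le_sq ?_ (by positivity)
  calc P x y ^ 2 ≤ P x x * P y y := P.toBilinForm.apply_sq_le_of_symm hnonneg ⟨hP⟩ x y
    _ ≤ (|C| * ‖x‖ ^ 2) * (|C| * ‖y‖ ^ 2) :=
      mul_le_mul (hle x) (hle y) (hnonneg y) ((hnonneg x).trans (hle x))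
    _ = (|C| * ‖x‖ * ‖y‖) ^ 2 := by ring

theorem exists_tendsto_subseq_of_norm_le {E : Type*} [NormedAddCommGroup E] [NormedSpace ℝ E]
    [FiniteDimensional ℝ E] {f : ℕ → E} {C : ℝ} (hf : ∀ n, ‖f n‖ ≤ C) :
    ∃ (a : E) (k : ℕ → ℕ), StrictMono k ∧ Tendsto (f ∘ k) atTop (𝓝 a) := by
  have : ProperSpace E := FiniteDimensional.proper_real E
  obtain ⟨a, -, k, hk, hlim⟩ := tendsto_subseq_of_bounded Metric.isBounded_closedBall
    fun n => mem_closedBall_zero_iff.2 (hf n)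
  exact ⟨a, k, hk, hlim⟩

theorem tendsto_clm_apply {ι E F : Type*} [NormedAddCommGroup E] [NormedSpace ℝ E]
    [NormedAddCommGroup F] [NormedSpace ℝ F] {l : Filter ι} {T : ι → E →L[ℝ] F} {T₀ : E →L[ℝ] F}
    (hT : Tendsto T l (𝓝 T₀)) {x : ι → E} {x₀ : E} (hx : Tendsto x l (𝓝 x₀)) :
    Tendsto (fun i => T i (x i)) l (𝓝 (T₀ x₀)) :=
  (isBoundedBilinearMap_apply.continuous.tendsto (T₀, x₀)).comp (hT.prodMk_nhds hx)

variable [CompleteSpace X] [CompleteSpace U] {A : X →L[ℝ] X} {B : U →L[ℝ] X}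
  {Q : X × U →L[ℝ] X × U →L[ℝ] ℝ}

theorem two_mul_form_le_of_tendsto {h : ℕ → ℝ} (hpos : ∀ n, 0 < h n)
    (hzero : Tendsto h atTop (𝓝 0)) {P : ℕ → X →L[ℝ] X →L[ℝ] ℝ} {P₀ : X →L[ℝ] X →L[ℝ] ℝ}
    (hP : ∀ n x y, P n x y = P n y x) (hP₀ : ∀ x y, P₀ x y = P₀ y x)
    (hlim : Tendsto P atTop (𝓝 P₀)) (z : X × U)
    (hle : ∀ n, P n (sampledFlow A B (h n) z) (sampledFlow A B (h n) z) - P n z.1 z.1 ≤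
      gramian (inputGen A B) Q (h n) z z + h n ^ 2 * ‖sampledFlow A B (h n) z‖ ^ 2) :
    2 * P₀ z.1 (A z.1 + B z.2) ≤ Q z z := by
  have hpunct : Tendsto h atTop (𝓝[≠] 0) :=
    tendsto_nhdsWithin_iff.2 ⟨hzero, .of_forall fun n => (hpos n).ne'⟩
  have hflow : Tendsto (fun n => sampledFlow A B (h n) z) atTop (𝓝 z.1) := by
    have := (hasDerivAt_sampledFlow (A := A) (B := B) z 0).continuousAt.tendsto
    rw [sampledFlow_zero] at this
    exact this.comp hzero
  have hslope : Tendsto (fun n => (h n)⁻¹ • (sampledFlow A B (h n) z - z.1)) atTop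
      (𝓝 (A z.1 + B z.2)) := by
    have := (hasDerivAt_sampledFlow (A := A) (B := B) z 0).tendsto_slope_zero.comp hpunct
    simpa only [Function.comp_def, zero_add, sampledFlow_zero] using this
  have hcost : Tendsto (fun n => (h n)⁻¹ * gramian (inputGen A B) Q (h n) z z) atTop
      (𝓝 (Q z z)) := by
    have := (hasDerivAt_gramian_apply (inputGen A B) Q z z 0).tendsto_slope_zero.comp hpunct
    simpa only [Function.comp_def, zero_add, gramian_zero, zero_apply, sub_zero, smul_eq_mul,
      linFlow_zero, one_apply_eq_self] using this
  have hleft := tendsto_clm_apply (tendsto_clm_apply hlim hslope) (hflow.add_const z.1)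
  have hright := hcost.add (hzero.mul (hflow.norm.pow 2))
  rw [zero_mul, add_zero] at hright
  rw [hP₀, two_mul, ← map_add]
  refine le_of_tendsto_of_tendsto' hleft hright fun n => ?_
  -- The increment of a quadratic form is the form paired between the increment and the sum.
  have hpair : P n (sampledFlow A B (h n) z - z.1) (sampledFlow A B (h n) z + z.1) =
      P n (sampledFlow A B (h n) z) (sampledFlow A B (h n) z) - P n z.1 z.1 := by
    simp only [map_sub, map_add, sub_apply]
    rw [hP n z.1]
    ring
  simp only [map_smul, smul_apply, smul_eq_mul, hpair]
  have := mul_le_mul_of_nonneg_left (hle n) (inv_nonneg.2 (hpos n).le)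
  refine this.trans_eq ?_
  field_simp [(hpos n).ne']

theorem exists_isStorageForm_of_sampled [FiniteDimensional ℝ X] {h : ℕ → ℝ} (hpos : ∀ n, 0 < h n)
    (hzero : Tendsto h atTop (𝓝 0)) {P : ℕ → X →L[ℝ] X →L[ℝ] ℝ}
    (hP : ∀ n x y, P n x y = P n y x) {a b : ℝ} (ha : 0 ≤ a)
    (hlow : ∀ n x, a * ‖x‖ ^ 2 ≤ P n x x) (hup : ∀ n x, P n x x ≤ b * ‖x‖ ^ 2)
    (hle : ∀ n z, P n (sampledFlow A B (h n) z) (sampledFlow A B (h n) z) - P n z.1 z.1 ≤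
      gramian (inputGen A B) Q (h n) z z + h n ^ 2 * ‖sampledFlow A B (h n) z‖ ^ 2) :
    ∃ P₀, IsStorageForm A B Q P₀ ∧ ∀ x, a * ‖x‖ ^ 2 ≤ P₀ x x ∧ P₀ x x ≤ b * ‖x‖ ^ 2 := by
  have hnonneg : ∀ n x, 0 ≤ P n x x := fun n x => le_trans (by positivity) (hlow n x)
  obtain ⟨P₀, k, hk, hlim⟩ :=
    exists_tendsto_subseq_of_norm_le (E := X →L[ℝ] X →L[ℝ] ℝ) fun n =>
      norm_form_le (hP n) (hnonneg n) (hup n)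
  have hlim' : ∀ x y, Tendsto (fun n => P (k n) x y) atTop (𝓝 (P₀ x y)) := fun x y =>
    tendsto_clm_apply (tendsto_clm_apply hlim tendsto_const_nhds) tendsto_const_nhds
  have hsymm : ∀ x y, P₀ x y = P₀ y x := fun x y =>
    tendsto_nhds_unique (hlim' x y) (by simpa only [hP _ x] using hlim' y x)
  refine ⟨P₀, ⟨hsymm, fun x u => ?_⟩, fun x => ⟨?_, ?_⟩⟩
  · exact two_mul_form_le_of_tendsto (fun n => hpos (k n)) (hzero.comp hk.tendsto_atTop)
      (fun n => hP (k n)) hsymm hlim (x, u) fun n => hle (k n) (x, u)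
  · exact ge_of_tendsto' (hlim' x x) fun n => hlow (k n) x
  · exact le_of_tendsto' (hlim' x x) fun n => hup (k n) x

end StorageForm

section AvailableStorage

variable {X U : Type*} [NormedAddCommGroup X] [NormedSpace ℝ X] [NormedAddCommGroup U]
  [NormedSpace ℝ U] [FiniteDimensional ℝ X]

theorem exists_form_isGLB_reach {φ : X × U →L[ℝ] X} {Q : X × U →L[ℝ] X × U →L[ℝ] ℝ}
    (hQ : ∀ x, Q (x, 0) (x, 0) ≤ 0) {κ : ℝ}
    (hlow : ∀ N x y a, Reach φ (fun z => Q z z) N x y a → -(κ * ‖x‖ ^ 2) ≤ a) :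
    ∃ B : X →L[ℝ] X →L[ℝ] ℝ, (∀ x y, B x y = B y x) ∧
      ∀ x, IsGLB {a | ∃ N y, Reach φ (fun z => Q z z) N x y a} (B x x) := by
  have hfamily : IsQuadraticFamily fun x => {a | ∃ N y, Reach φ (fun z => Q z z) N x y a} := by
    refine ⟨fun t x a ⟨N, y, h⟩ => ⟨N, _, h.smul t⟩, ?_⟩
    rintro x y a b ⟨N, x', hx⟩ ⟨M, y', hy⟩
    obtain ⟨_, a', hx, ha⟩ := hx.exists_extend hQ M
    obtain ⟨_, b', hy, hb⟩ := hy.exists_extend hQ N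
    obtain ⟨c, d, hc, hd, h⟩ := hx.parallelogram (add_comm M N ▸ hy)
    exact ⟨c, ⟨_, _, hc⟩, d, ⟨_, _, hd⟩, by linarith⟩
  exact hfamily.exists_isGLB (fun x a ⟨N, y, h⟩ => hlow N x y a h)
    fun x => ⟨0, ⟨0, x, .refl x⟩, by linarith [hlow 0 x x 0 (.refl x)]⟩

theorem exists_discrete_available_storage {φ : X × U →L[ℝ] X} {Q : X × U →L[ℝ] X × U →L[ℝ] ℝ}
    (hQ : ∀ x, Q (x, 0) (x, 0) ≤ 0) {κ : ℝ}
    (hlow : ∀ N x y a, Reach φ (fun z => Q z z) N x y a → -(κ * ‖x‖ ^ 2) ≤ a) :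
    ∃ P : X →L[ℝ] X →L[ℝ] ℝ, (∀ x y, P x y = P y x) ∧ (∀ x, 0 ≤ P x x ∧ P x x ≤ κ * ‖x‖ ^ 2) ∧
      ∀ z, P (φ z) (φ z) - P z.1 z.1 ≤ Q z z := by
  obtain ⟨B, hB, hglb⟩ := exists_form_isGLB_reach hQ hlow
  refine ⟨-B, fun x y => congrArg Neg.neg (hB x y), fun x => ⟨?_, ?_⟩, fun z => ?_⟩
  · exact neg_nonneg.2 ((hglb x).1 ⟨0, x, .refl x⟩)
  · exact neg_le.1 ((hglb x).2 fun a ⟨N, y, h⟩ => hlow N x y a h)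
  · have hle : B z.1 z.1 - Q z z ≤ B (φ z) (φ z) := (hglb (φ z)).2 fun a ⟨N, y, h⟩ => by
      linarith [(hglb z.1).1 ⟨_, y, (Reach.single z.1 z.2).trans h⟩]
    simp only [neg_apply]
    linarith

/-- Every sampled trajectory of `ẋ = A x + B u` from `x` to `y` costs at least
`c ‖y‖ ^ 2 - κ ‖x‖ ^ 2`, whatever the sampling period. -/
def IsEnergyBounded (A : X →L[ℝ] X) (B : U →L[ℝ] X)
    (Q : X × U →L[ℝ] X × U →L[ℝ] ℝ) (c κ : ℝ) : Prop :=
  ∀ h, 0 ≤ h → ∀ N x y a, SampledReach A B Q h N x y a → c * ‖y‖ ^ 2 - κ * ‖x‖ ^ 2 ≤ a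

variable [CompleteSpace U] {A : X →L[ℝ] X} {B : U →L[ℝ] X} {Q : X × U →L[ℝ] X × U →L[ℝ] ℝ}

theorem gramian_inputGen_zero_input_nonpos (hQ : ∀ x, Q (x, 0) (x, 0) ≤ 0) {h : ℝ} (hh : 0 ≤ h)
    (x : X) : gramian (inputGen A B) Q h (x, 0) (x, 0) ≤ 0 := by
  rw [gramian_apply, ← neg_nonneg, ← intervalIntegral.integral_neg]
  refine intervalIntegral.integral_nonneg hh fun t _ => neg_nonneg.2 ?_
  simpa only [linFlow_inputGen] using hQ _

theorem IsEnergyBounded.exists_available_storage (hQ : ∀ x, Q (x, 0) (x, 0) ≤ 0) {c κ : ℝ}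
    (hc : 0 ≤ c) (hbound : IsEnergyBounded A B Q c κ) :
    ∃ P, IsStorageForm A B Q P ∧ ∀ x, 0 ≤ P x x ∧ P x x ≤ κ * ‖x‖ ^ 2 := by
  have hsampled : ∀ n : ℕ, _ := fun n =>
    let h : ℝ := 1 / (n + 1)
    have hh : 0 ≤ h := by positivity
    exists_discrete_available_storage (φ := sampledFlow A B h)
      (gramian_inputGen_zero_input_nonpos hQ hh) (κ := κ) fun N x y a hR => by
        have : 0 ≤ c * ‖y‖ ^ 2 := by positivity
        linarith [hbound h hh N x y a hR]
  choose P hP hbounds hdiss using hsampled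
  obtain ⟨P₀, hP₀, hP₀b⟩ := exists_isStorageForm_of_sampled (a := 0) (fun n => by positivity)
    tendsto_one_div_add_atTop_nhds_zero_nat hP le_rfl
    (fun n x => by simpa using (hbounds n x).1) (fun n x => (hbounds n x).2)
    fun n z => (hdiss n z).trans (le_add_of_nonneg_right (by positivity))
  exact ⟨P₀, hP₀, fun x => by simpa using hP₀b x⟩

end AvailableStorage

section PositiveOnSphere

variable {X : Type*} [NormedAddCommGroup X] [NormedSpace ℝ X] [FiniteDimensional ℝ X]

theorem exists_pos_le_on_sphere {V : X → ℝ} (hcont : Continuous V) (hpos : ∀ x ≠ 0, 0 < V x) :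
    ∃ c > 0, ∀ x, ‖x‖ = 1 → c ≤ V x := by
  rcases (Metric.sphere (0 : X) 1).eq_empty_or_nonempty with hempty | hne
  · exact ⟨1, one_pos, fun x hx => absurd (mem_sphere_zero_iff_norm.2 hx) (by simp [hempty])⟩
  obtain ⟨x₀, hx₀, hmin⟩ := (isCompact_sphere (0 : X) 1).exists_isMinOn hne hcont.continuousOn
  have hx₀ : x₀ ≠ 0 := ne_zero_of_mem_sphere one_ne_zero ⟨x₀, hx₀⟩
  exact ⟨V x₀, hpos x₀ hx₀, fun x hx => hmin (mem_sphere_zero_iff_norm.2 hx)⟩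

theorem exists_pos_mul_sq_le_form {P : X →L[ℝ] X →L[ℝ] ℝ} (hpos : ∀ x ≠ 0, 0 < P x x) :
    ∃ c > 0, ∀ x, c * ‖x‖ ^ 2 ≤ P x x := by
  obtain ⟨c, hc, hle⟩ := exists_pos_le_on_sphere (V := fun x => P x x) (by fun_prop) hpos
  refine ⟨c, hc, fun x => ?_⟩
  rcases eq_or_ne x 0 with rfl | hx
  · simp
  have hnorm : 0 < ‖x‖ := norm_pos_iff.2 hx
  have h := hle (‖x‖⁻¹ • x) (by rw [norm_smul, norm_inv, norm_norm, inv_mul_cancel₀ hnorm.ne'])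
  simp only [map_smul, smul_apply, smul_eq_mul] at h
  calc c * ‖x‖ ^ 2 ≤ ‖x‖⁻¹ * (‖x‖⁻¹ * P x x) * ‖x‖ ^ 2 := by gcongr
    _ = P x x := by field_simp

end PositiveOnSphere

section LyapunovForm

variable {X : Type*} [NormedAddCommGroup X] [InnerProductSpace ℝ X] {A π : X →L[ℝ] X}

/-- A quadratic form which dominates `K ‖y‖ ^ 2` and, along the part of `ẋ = A x + d` living in the
kernel of the projection `π`, decreases at the rate `K ‖y‖ ^ 2` up to the gain `g ‖d‖ ^ 2`. -/
structure IsLyapunovForm (A π : X →L[ℝ] X) (Γ : X →L[ℝ] X →L[ℝ] ℝ) (K g : ℝ) : Prop where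
  symm : ∀ x y, Γ x y = Γ y x
  mul_sq_le : ∀ y, K * ‖y‖ ^ 2 ≤ Γ y y
  decay : ∀ y d, π y = 0 → 2 * Γ y (A y + (1 - π) d) ≤ g * ‖d‖ ^ 2 - K * ‖y‖ ^ 2

theorem gramian_innerSL_pos [CompleteSpace X] {t : ℝ} (ht : 0 < t) {x : X} (hx : x ≠ 0) :
    0 < gramian A (innerSL ℝ) t x x := by
  rw [gramian_apply]
  refine intervalIntegral.intervalIntegral_pos_of_pos_on
    ((continuous_form_linFlow A _ x x).intervalIntegrable _ _) (fun s _ => ?_) ht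
  refine real_inner_self_pos.2 fun h0 => hx ?_
  have h := DFunLike.congr_fun (linFlow_mul_linFlow_neg A (-s)) x
  rw [neg_neg, mul_apply_eq_comp, h0, map_zero, one_apply_eq_self] at h
  exact h.symm

theorem IsCenterProjection.exists_decay [CompleteSpace X] (hπ : IsCenterProjection A π) :
    ∃ τ > 0, ∃ k > 0, ∀ y, π y = 0 → 2 * gramian A (innerSL ℝ) τ y (A y) ≤ -(k * ‖y‖ ^ 2) := by
  obtain ⟨τ, hτ, hcontr⟩ := hπ.exists_contraction
  refine ⟨τ, hτ, 1 - ‖linFlow A τ * (1 - π)‖ ^ 2, ?_, fun y hy => ?_⟩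
  · exact sub_pos.2 (pow_lt_one₀ (norm_nonneg _) hcontr two_ne_zero)
  have hle : ‖linFlow A τ y‖ ≤ ‖linFlow A τ * (1 - π)‖ * ‖y‖ := by
    have := (linFlow A τ * (1 - π)).le_opNorm y
    rwa [mul_apply_eq_comp, sub_apply, hy, sub_zero, one_apply_eq_self] at this
  rw [two_mul_gramian_apply_gen fun x y => real_inner_comm y x, innerSL_apply_apply,
    innerSL_apply_apply, real_inner_self_eq_norm_sq, real_inner_self_eq_norm_sq]
  linarith [pow_le_pow_left₀ (norm_nonneg _) hle 2, mul_pow ‖linFlow A τ * (1 - π)‖ ‖y‖ 2]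

theorem IsCenterProjection.exists_isLyapunovForm [FiniteDimensional ℝ X]
    (hπ : IsCenterProjection A π) {K : ℝ} (hK : 0 ≤ K) :
    ∃ Γ g, IsLyapunovForm A π Γ K g := by
  obtain ⟨τ, hτ, k, hk, hdecay⟩ := hπ.exists_decay
  obtain ⟨b, hb, hlow⟩ := exists_pos_mul_sq_le_form fun x hx =>
    gramian_innerSL_pos (A := A) hτ (x := x) hx
  set Γ := gramian A (innerSL ℝ) τ
  obtain ⟨s, hs, hsb, hsk⟩ : ∃ s : ℝ, 0 ≤ s ∧ K ≤ s * b ∧ K + 1 ≤ s * k :=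
    ⟨K / b + (K + 1) / k, by positivity, by field_simp; nlinarith, by field_simp; nlinarith⟩
  refine ⟨s • Γ, (s * ‖Γ‖ * ‖1 - π‖) ^ 2, fun x y => ?_, fun y => ?_,
    fun y d hy => ?_⟩
  · exact congrArg (s * ·) (gramian_comm (fun x y => real_inner_comm y x) τ x y)
  · calc K * ‖y‖ ^ 2 ≤ s * b * ‖y‖ ^ 2 := by gcongr
      _ = s * (b * ‖y‖ ^ 2) := mul_assoc _ _ _
      _ ≤ s * Γ y y := by gcongr; exact hlow y
  · have hcross : s * Γ y ((1 - π) d) ≤ ‖y‖ * (s * ‖Γ‖ * ‖1 - π‖ * ‖d‖) :=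
      calc s * Γ y ((1 - π) d) ≤ s * (‖Γ‖ * ‖y‖ * (‖1 - π‖ * ‖d‖)) := by
            gcongr
            exact (le_abs_self _).trans ((Γ.le_opNorm₂ _ _).trans (by
              gcongr; exact (1 - π).le_opNorm d))
        _ = _ := by ring
    have hflow : s * (2 * Γ y (A y)) ≤ -((K + 1) * ‖y‖ ^ 2) :=
      calc s * (2 * Γ y (A y)) ≤ s * -(k * ‖y‖ ^ 2) := by gcongr; exact hdecay y hy
        _ = -(s * k * ‖y‖ ^ 2) := by ring
        _ ≤ _ := by gcongr
    simp only [smul_apply, smul_eq_mul, map_add]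
    linarith [two_mul_le_add_sq ‖y‖ (s * ‖Γ‖ * ‖1 - π‖ * ‖d‖),
      mul_pow (s * ‖Γ‖ * ‖1 - π‖) ‖d‖ 2]

end LyapunovForm

section DisturbedSystem

section

variable {X U : Type*} [NormedAddCommGroup X] [NormedSpace ℝ X] [NormedAddCommGroup U]
  [NormedSpace ℝ U] {A : X →L[ℝ] X} {B : U →L[ℝ] X} {Q : X × U →L[ℝ] X × U →L[ℝ] ℝ}
  {P : X →L[ℝ] X →L[ℝ] ℝ}

theorem IsStorageForm.exists_sub_form_le (hP : IsStorageForm A B Q P) :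
    ∃ K, 0 ≤ K ∧ ∀ x y u, Q (x - y, u) (x - y, u) - 2 * P (x - y) (A (x - y) + B u) ≤
      2 * (Q (x, u) (x, u) - 2 * P x (A x + B u)) + K * ‖y‖ ^ 2 := by
  let D := Q - (2 : ℝ) • P.bilinearComp (.fst ℝ X U) (A.coprod B)
  have hD : ∀ x u, D (x, u) (x, u) = Q (x, u) (x, u) - 2 * P x (A x + B u) := fun x u => rfl
  refine ⟨2 * ‖D‖, by positivity, fun x y u => ?_⟩
  have hsub := form_sub_self_le (Q := D)
    (fun z => (hD z.1 z.2).symm ▸ sub_nonneg.2 (hP.dissipation z.1 z.2)) (x, u) (y, 0)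
  rw [Prod.mk_sub_mk, sub_zero, hD, hD] at hsub
  have hy : D (y, 0) (y, 0) ≤ ‖D‖ * ‖y‖ ^ 2 := by
    simpa [mul_assoc, sq] using (le_abs_self _).trans (D.le_opNorm₂ (y, 0) (y, 0))
  linarith

variable [CompleteSpace X]

theorem IsCenterProjection.apply_sampledFlow_eq_zero {π : X →L[ℝ] X} (hπ : IsCenterProjection A π)
    {y : X} (hy : π y = 0) (d : X) (t : ℝ) : π (sampledFlow A (1 - π) t (y, d)) = 0 := by
  have hkill : π ((1 - π) d) = 0 := by
    rw [sub_apply, map_sub, one_apply_eq_self, ← mul_apply_eq_comp, hπ.mul_self, sub_self]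
  have hderiv := fun t => π.hasFDerivAt.comp_hasDerivAt t
    (hasDerivAt_sampledFlow (A := A) (B := 1 - π) (y, d) t)
  simp only [map_add, hkill, add_zero, hπ.apply_gen] at hderiv
  have h := eq_linFlow_of_hasDerivAt hderiv t
  simpa only [Function.comp_apply, sampledFlow_zero, hy, map_zero] using h

end

variable {X U : Type*} [NormedAddCommGroup X] [InnerProductSpace ℝ X] [NormedAddCommGroup U]
  [NormedSpace ℝ U]

/-- The supply rate `Q ((x, u), (x, u)) + 2 P (x, ρ d) + g ‖d‖ ^ 2` of the disturbed system
`ẋ = A x + B u + ρ d`, whose input is the pair `(u, d)`. -/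
noncomputable def disturbedSupply (Q : X × U →L[ℝ] X × U →L[ℝ] ℝ) (P : X →L[ℝ] X →L[ℝ] ℝ)
    (ρ : X →L[ℝ] X) (g : ℝ) : X × (U × X) →L[ℝ] X × (U × X) →L[ℝ] ℝ :=
  let dist : X × (U × X) →L[ℝ] X := (ContinuousLinearMap.snd ℝ U X).comp (.snd ℝ X (U × X))
  let undist := (ContinuousLinearMap.id ℝ X).prodMap (.fst ℝ U X)
  let sqNorm : X →L[ℝ] X →L[ℝ] ℝ := innerSL ℝ
  Q.bilinearComp undist undist + (2 : ℝ) • P.bilinearComp (.fst ℝ X (U × X)) (ρ.comp dist) +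
    g • sqNorm.bilinearComp dist dist

theorem disturbedSupply_apply (Q : X × U →L[ℝ] X × U →L[ℝ] ℝ) (P : X →L[ℝ] X →L[ℝ] ℝ)
    (ρ : X →L[ℝ] X) (g : ℝ) (x : X) (u : U) (d : X) :
    disturbedSupply Q P ρ g (x, (u, d)) (x, (u, d)) =
      Q (x, u) (x, u) + 2 * P x (ρ d) + g * ‖d‖ ^ 2 := by
  rw [← real_inner_self_eq_norm_sq]
  rfl

variable {A π : X →L[ℝ] X} {B : U →L[ℝ] X} {Q : X × U →L[ℝ] X × U →L[ℝ] ℝ}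
  {P Γ : X →L[ℝ] X →L[ℝ] ℝ}

theorem IsStorageForm.of_disturbed {P' : X →L[ℝ] X →L[ℝ] ℝ} {ρ : X →L[ℝ] X} {g : ℝ}
    (hP : IsStorageForm (U := U × X) A (B.coprod ρ) (disturbedSupply Q P ρ g) P') :
    IsStorageForm A B Q P' := by
  refine ⟨hP.symm, fun x u => ?_⟩
  have h := hP.dissipation x (u, 0)
  rw [disturbedSupply_apply] at h
  simpa using h

/-- `Γ` compensates the disturbance `d` of the system `ẋ = A x + B u + (1 - π) d`: if `y` is the
part of the state `x` caused by the disturbance, then the storage function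
`P (x, x) + Γ (y, y) - P (x - y, x - y) / 2` pays for half of the supply of the undisturbed motion
`x - y`. -/
structure IsCompensator (A π : X →L[ℝ] X) (B : U →L[ℝ] X) (Q : X × U →L[ℝ] X × U →L[ℝ] ℝ)
    (P Γ : X →L[ℝ] X →L[ℝ] ℝ) (g : ℝ) : Prop where
  symm : ∀ x y, Γ x y = Γ y x
  dissipation : ∀ x y u d, π y = 0 →
    2 * P x (A x + (B u + (1 - π) d)) + 2 * Γ y (A y + (1 - π) d) -
        P (x - y) (A (x - y) + B u) + Q (x - y, u) (x - y, u) / 2 ≤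
      disturbedSupply Q P (1 - π) g (x, (u, d)) (x, (u, d))

variable [FiniteDimensional ℝ X]

theorem IsCenterProjection.exists_isCompensator (hπ : IsCenterProjection A π)
    (hP : IsStorageForm A B Q P) {K : ℝ} (hK : 0 ≤ K) :
    ∃ Γ g, (∀ y, K * ‖y‖ ^ 2 ≤ Γ y y) ∧ IsCompensator A π B Q P Γ g := by
  obtain ⟨K', hK', hsub⟩ := hP.exists_sub_form_le
  obtain ⟨Γ, g, hΓ⟩ := hπ.exists_isLyapunovForm (add_nonneg hK hK')
  refine ⟨Γ, g, fun y => ?_, hΓ.symm, fun x y u d hy => ?_⟩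
  · refine le_trans ?_ (hΓ.mul_sq_le y)
    gcongr
    exact le_add_of_nonneg_right hK'
  · have hpos : 0 ≤ K * ‖y‖ ^ 2 := by positivity
    have hpos' : 0 ≤ K' * ‖y‖ ^ 2 := by positivity
    have hdecay := hΓ.decay y d hy
    rw [add_mul] at hdecay
    rw [disturbedSupply_apply, ← add_assoc, map_add]
    linarith [hsub x y u]

variable [CompleteSpace U] {g : ℝ}

theorem IsCompensator.sampled_dissipation (hΓ : IsCompensator A π B Q P Γ g)
    (hπ : IsCenterProjection A π) (hP : ∀ x y, P x y = P y x) {h : ℝ} (hh : 0 ≤ h) (v y : X)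
    (u : U) (d : X) (hy : π y = 0) :
    let v' := sampledFlow A B h (v, u)
    let y' := sampledFlow A (1 - π) h (y, d)
    P (v' + y') (v' + y') + Γ y' y' - P v' v' / 2 + gramian (inputGen A B) Q h (v, u) (v, u) / 2 -
        (P (v + y) (v + y) + Γ y y - P v v / 2) ≤
      gramian (inputGen A (B.coprod (1 - π))) (disturbedSupply Q P (1 - π) g) h
        (v + y, (u, d)) (v + y, (u, d)) := by
  have hv := hasDerivAt_sampledFlow (A := A) (B := B) (v, u)
  have hy' := hasDerivAt_sampledFlow (A := A) (B := 1 - π) (y, d)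
  have hderiv := fun t =>
    (((hasDerivAt_form_apply_self hP ((hv t).add (hy' t))).add
      (hasDerivAt_form_apply_self hΓ.symm (hy' t))).sub
      ((hasDerivAt_form_apply_self hP (hv t)).div_const 2)).add
      ((hasDerivAt_gramian_apply (inputGen A B) Q (v, u) (v, u) t).div_const 2)
  have hle := sub_le_gramian (A := inputGen A (B.coprod (1 - π)))
    (Q := disturbedSupply Q P (1 - π) g) (x := (v + y, (u, d))) hh hderiv fun t => by
      rw [linFlow_inputGen, linFlow_inputGen, sampledFlow_coprod]
      refine le_trans (le_of_eq ?_) <| hΓ.dissipation (sampledFlow A B t (v, u) +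
        sampledFlow A (1 - π) t (y, d)) _ u d (hπ.apply_sampledFlow_eq_zero hy d t)
      simp only [Pi.add_apply, add_sub_cancel_right, map_add, add_apply]
      ring
  simpa only [Pi.add_apply, Pi.sub_apply, sampledFlow_zero, gramian_zero, zero_apply, zero_div,
    add_zero] using hle

theorem IsCompensator.exists_sampledReach (hΓ : IsCompensator A π B Q P Γ g)
    (hπ : IsCenterProjection A π) (hP : ∀ x y, P x y = P y x) {h : ℝ} (hh : 0 ≤ h) {N : ℕ}
    {x₀ x : X} {a : ℝ} (hR : SampledReach (U := U × X) A (B.coprod (1 - π))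
      (disturbedSupply Q P (1 - π) g) h N x₀ x a) :
    ∃ v y a', x = v + y ∧ π y = 0 ∧ SampledReach A B Q h N x₀ v a' ∧
      P x x + Γ y y - P v v / 2 + a' / 2 - P x₀ x₀ / 2 ≤ a := by
  induction hR with
  | refl x₀ => exact ⟨x₀, 0, 0, (add_zero x₀).symm, map_zero π, .refl x₀, by simp⟩
  | @step N x₀ x a w _ ih =>
    obtain ⟨v, y, a', rfl, hy, hv, ha⟩ := ih
    obtain ⟨u, d⟩ := w
    refine ⟨_, _, _, sampledFlow_coprod h v y u d, hπ.apply_sampledFlow_eq_zero hy d h,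
      hv.step u, ?_⟩
    rw [sampledFlow_coprod]
    linarith [hΓ.sampled_dissipation hπ hP hh v y u d hy]

theorem IsCompensator.isEnergyBounded (hΓ : IsCompensator A π B Q P Γ g)
    (hπ : IsCenterProjection A π) (hP : ∀ x y, P x y = P y x) {c κ : ℝ} (hc : 0 ≤ c)
    (hbound : IsEnergyBounded A B Q c κ) (hnonneg : ∀ x, 0 ≤ P x x)
    (hle : ∀ x, P x x ≤ κ * ‖x‖ ^ 2) (hK : ∀ y, (κ + c / 2) * ‖y‖ ^ 2 ≤ Γ y y) :
    IsEnergyBounded (U := U × X) A (B.coprod (1 - π)) (disturbedSupply Q P (1 - π) g)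
      (c / 4) κ := by
  intro h hh N x₀ x a hR
  obtain ⟨v, y, a', rfl, -, hv, ha⟩ := hΓ.exists_sampledReach hπ hP hh hR
  have hPv : P v v ≤ 2 * P (v + y) (v + y) + 2 * P y y := by
    simpa using form_sub_self_le hnonneg (v + y) y
  have hnorm : c * ‖v + y‖ ^ 2 ≤ c * (2 * (‖v‖ ^ 2 + ‖y‖ ^ 2)) := by
    gcongr
    exact (pow_le_pow_left₀ (norm_nonneg _) (norm_add_le v y) 2).trans add_sq_le
  linarith [hbound h hh N x₀ v a' hv, hle x₀, hle y, hK y]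

end DisturbedSystem

section Steering

variable {X U : Type*} [NormedAddCommGroup X] [NormedSpace ℝ X] [CompleteSpace X]
  [NormedAddCommGroup U] [NormedSpace ℝ U] [CompleteSpace U] {A π : X →L[ℝ] X} {B : U →L[ℝ] X}
  {D : X →L[ℝ] U}

theorem sampledFlow_equilibrium_input {v : X} {w : U} (hw : B w = A v) (t : ℝ) (x : X) :
    sampledFlow A B t (x, w) = linFlow A t (x + v) - v := by
  have h := eq_sampledFlow_of_hasDerivAt (A := A) (B := B) (u := w)
    (x := fun t => linFlow A t (x + v) - v) (fun t =>
      ((hasDerivAt_linFlow_apply A (x + v) t).sub_const v).congr_deriv <| by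
        rw [hw, map_sub, sub_add_cancel]) t
  rw [h, linFlow_zero, one_apply_eq_self, add_sub_cancel_right]

theorem IsCenterProjection.exists_sub_linFlow_eq (hπ : IsCenterProjection A π) {τ : ℝ}
    (hτ : ‖linFlow A τ * (1 - π)‖ < 1) :
    ∃ v : X →L[ℝ] X, ∀ x, π (v x) = 0 ∧ v x - linFlow A τ (v x) = π x - x := by
  obtain ⟨N, hN⟩ := isUnit_one_sub_of_norm_lt_one hτ
  let v : X →L[ℝ] X := (N⁻¹).val * (π - 1)
  have hv : ∀ x, v x - linFlow A τ (v x - π (v x)) = π x - x := fun x => by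
    have h : (N : X →L[ℝ] X) * v = π - 1 := N.mul_inv_cancel_left _
    simpa [hN] using DFunLike.congr_fun h x
  have hπv : ∀ x, π (v x) = 0 := fun x => by
    have hidem : ∀ y, π (π y) = π y := DFunLike.congr_fun hπ.mul_self
    have hcomm : ∀ y, linFlow A τ (π y) = π (linFlow A τ y) :=
      DFunLike.congr_fun (hπ.linFlow_mul τ)
    have h := congrArg π (hv x)
    rwa [map_sub, ← hcomm, map_sub π, hidem, sub_self, map_zero, sub_zero, map_sub, hidem,
      sub_self] at h
  refine ⟨v, fun x => ⟨hπv x, ?_⟩⟩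
  simpa only [hπv, sub_zero] using hv x

theorem IsCenterProjection.exists_sampledFlow_eq (hπ : IsCenterProjection A π)
    (hD : ∀ x, B (D x) = x - π x) {τ : ℝ} (hτ : ‖linFlow A τ * (1 - π)‖ < 1) :
    ∃ Z : X →L[ℝ] X × U, ∀ x, (Z x).1 = linFlow A (-τ) (π x) ∧ sampledFlow A B τ (Z x) = x := by
  obtain ⟨v, hv⟩ := hπ.exists_sub_linFlow_eq hτ
  refine ⟨(linFlow A (-τ) * π).prod (D.comp (A * v)), fun x => ⟨rfl, ?_⟩⟩
  obtain ⟨hπv, hvx⟩ := hv x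
  have hw : B (D (A (v x))) = A (v x) := by rw [hD, hπ.apply_gen, hπv, map_zero, sub_zero]
  calc sampledFlow A B τ (linFlow A (-τ) (π x), D (A (v x)))
      = linFlow A τ (linFlow A (-τ) (π x) + v x) - v x := sampledFlow_equilibrium_input hw τ _
    _ = π x - (v x - linFlow A τ (v x)) := by
      rw [map_add, ← linFlow_add_apply, add_neg_cancel, linFlow_zero, one_apply_eq_self]
      abel
    _ = x := by rw [hvx, sub_sub_cancel]

end Steering

section SteeringCost

variable {X U : Type*} [NormedAddCommGroup X] [NormedSpace ℝ X] [NormedAddCommGroup U]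
  [NormedSpace ℝ U] [CompleteSpace U] {A π : X →L[ℝ] X} {B : U →L[ℝ] X} {D : X →L[ℝ] U}

variable [FiniteDimensional ℝ X] {Q : X × U →L[ℝ] X × U →L[ℝ] ℝ}

theorem IsCenterProjection.exists_sampledReach_le (hπ : IsCenterProjection A π)
    (hD : ∀ x, B (D x) = x - π x) (hQ : ∀ x, Q (x, 0) (x, 0) ≤ 0) :
    ∃ τ > 0, ∃ M C, ∀ (n k : ℕ) x, ∃ x₀ a,
      SampledReach A B Q (τ / (n + 1)) (k + (n + 1)) x₀ x a ∧
        ‖x₀‖ ≤ M * ‖x‖ ∧ a ≤ C * ‖x‖ ^ 2 := by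
  obtain ⟨τ, hτ, hcontr⟩ := hπ.exists_contraction
  obtain ⟨M, hM⟩ := hπ.exists_bound
  obtain ⟨Z, hZ⟩ := hπ.exists_sampledFlow_eq hD hcontr
  let G := (gramian (inputGen A B) Q τ).bilinearComp Z Z
  refine ⟨τ, hτ, M, ‖G‖, fun n k x => ?_⟩
  set h := τ / (n + 1)
  have : 0 < h := by positivity
  let x₀ := linFlow A (-(τ + k * h)) (π x)
  -- The center part of `x` is reached without input, the contracted part with a constant input.
  have hcenter : SampledReach A B Q h k x₀ (Z x).1
      (gramian (inputGen A B) Q (k * h) (x₀, 0) (x₀, 0)) := by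
    refine (sampledReach_const A B Q h k (x₀, 0)).cast ?_ rfl
    rw [sampledFlow_zero_input, ← linFlow_add_apply, (hZ x).1]
    congr 2
    ring
  have hcontracted : SampledReach A B Q h (n + 1) (Z x).1 x (G x x) := by
    have hτh : ((n + 1 : ℕ) : ℝ) * h = τ := by
      push_cast
      exact mul_div_cancel₀ τ (by positivity)
    refine (sampledReach_const A B Q h (n + 1) (Z x)).cast ?_ ?_
    · rw [hτh, (hZ x).2]
    · rw [hτh]; rfl
  refine ⟨x₀, _, hcenter.trans hcontracted, ?_, ?_⟩
  · exact (linFlow A (-(τ + k * h)) * π).le_of_opNorm_le (hM _ (by positivity)) x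
  · have hG : G x x ≤ ‖G‖ * ‖x‖ ^ 2 := by
      simpa [mul_assoc, sq] using (le_abs_self _).trans (G.le_opNorm₂ x x)
    have hfree := gramian_inputGen_zero_input_nonpos (A := A) (B := B) hQ
      (h := k * h) (by positivity) x₀
    linarith

end SteeringCost

section RequiredSupply

variable {X U : Type*} [NormedAddCommGroup X] [InnerProductSpace ℝ X] [FiniteDimensional ℝ X]
  [NormedAddCommGroup U] [NormedSpace ℝ U] {φ : X × U →L[ℝ] X} {Q : X × U →L[ℝ] X × U →L[ℝ] ℝ}

theorem exists_form_isGLB_required_supply {N : ℕ} {κ C : ℝ} (hC : 0 ≤ C)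
    (hlow : ∀ x₀ x a, Reach φ (fun z => Q z z) N x₀ x a → 0 ≤ κ * ‖x₀‖ ^ 2 + a)
    (hup : ∀ x, ∃ x₀ a, Reach φ (fun z => Q z z) N x₀ x a ∧ κ * ‖x₀‖ ^ 2 + a ≤ C * ‖x‖ ^ 2) :
    ∃ V : X →L[ℝ] X →L[ℝ] ℝ, (∀ x y, V x y = V y x) ∧ ∀ x,
      IsGLB {b | ∃ x₀ a, Reach φ (fun z => Q z z) N x₀ x a ∧ b = κ * ‖x₀‖ ^ 2 + a} (V x x) := by
  refine IsQuadraticFamily.exists_isGLB (C := C) ⟨?_, ?_⟩ ?_ fun x => ?_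
  · rintro t x _ ⟨x₀, a, hR, rfl⟩
    refine ⟨t • x₀, t ^ 2 * a, hR.smul t, ?_⟩
    rw [norm_smul, mul_pow, Real.norm_eq_abs, sq_abs]
    ring
  · rintro x y _ _ ⟨x₀, a, hx, rfl⟩ ⟨y₀, b, hy, rfl⟩
    obtain ⟨c, d, hc, hd, hcd⟩ := hx.parallelogram hy
    refine ⟨_, ⟨_, c, hc, rfl⟩, _, ⟨_, d, hd, rfl⟩, le_of_eq ?_⟩
    linear_combination hcd + κ * parallelogram_law_with_norm ℝ x₀ y₀
  · rintro x _ ⟨x₀, a, hR, rfl⟩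
    have : 0 ≤ C * ‖x‖ ^ 2 := by positivity
    linarith [hlow x₀ x a hR]
  · obtain ⟨x₀, a, hR, hle⟩ := hup x
    exact ⟨_, ⟨x₀, a, hR, rfl⟩, hle⟩

theorem exists_discrete_required_supply {m : ℕ} {c κ C : ℝ} (hc : 0 ≤ c) (hC : 0 ≤ C)
    (hlow : ∀ N x₀ x a, Reach φ (fun z => Q z z) N x₀ x a → c * ‖x‖ ^ 2 - κ * ‖x₀‖ ^ 2 ≤ a)
    (hup : ∀ k x, ∃ x₀ a, Reach φ (fun z => Q z z) (k + m) x₀ x a ∧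
      κ * ‖x₀‖ ^ 2 + a ≤ C * ‖x‖ ^ 2) :
    ∃ V : ℕ → X →L[ℝ] X →L[ℝ] ℝ, (∀ k x y, V k x y = V k y x) ∧
      (∀ k x, c * ‖x‖ ^ 2 ≤ V k x x ∧ V k x x ≤ C * ‖x‖ ^ 2) ∧
      ∀ k z, V (k + 1) (φ z) (φ z) ≤ V k z.1 z.1 + Q z z := by
  choose V hsymm hglb using fun k => exists_form_isGLB_required_supply (N := k + m) (κ := κ) hC
    (fun x₀ x a hR => by
      have : 0 ≤ c * ‖x‖ ^ 2 := by positivity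
      linarith [hlow _ x₀ x a hR]) (hup k)
  refine ⟨V, hsymm, fun k x => ⟨(hglb k x).2 ?_, ?_⟩, fun k z => ?_⟩
  · rintro _ ⟨x₀, a, hR, rfl⟩
    linarith [hlow _ x₀ x a hR]
  · obtain ⟨x₀, a, hR, hle⟩ := hup k x
    exact ((hglb k x).1 ⟨x₀, a, hR, rfl⟩).trans hle
  · rw [← sub_le_iff_le_add]
    refine (hglb k z.1).2 ?_
    rintro _ ⟨x₀, a, hR, rfl⟩
    have hR' := hR.step z.2
    rw [Nat.add_right_comm] at hR'
    linarith [(hglb (k + 1) (φ z)).1 ⟨x₀, _, hR', rfl⟩]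

end RequiredSupply

section CoerciveStorage

open Filter Topology

theorem exists_average_dissipation {X U : Type*} [NormedAddCommGroup X] [NormedSpace ℝ X]
    {φ : X × U → X} {q : X × U → ℝ} {V : ℕ → X →L[ℝ] X →L[ℝ] ℝ}
    (hV : ∀ k x y, V k x y = V k y x) {c C : ℝ} (hc : 0 ≤ c)
    (hbounds : ∀ k x, c * ‖x‖ ^ 2 ≤ V k x x ∧ V k x x ≤ C * ‖x‖ ^ 2)
    (hstep : ∀ k z, V (k + 1) (φ z) (φ z) ≤ V k z.1 z.1 + q z) {ε : ℝ} (hε : 0 < ε) :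
    ∃ P : X →L[ℝ] X →L[ℝ] ℝ, (∀ x y, P x y = P y x) ∧
      (∀ x, c * ‖x‖ ^ 2 ≤ P x x ∧ P x x ≤ C * ‖x‖ ^ 2) ∧
      ∀ z, P (φ z) (φ z) - P z.1 z.1 ≤ q z + ε * ‖φ z‖ ^ 2 := by
  obtain ⟨m, hm⟩ := exists_nat_gt (max 0 (C / ε))
  have hmpos : (0 : ℝ) < m := (le_max_left _ _).trans_lt hm
  have hCm : C ≤ ε * m := by
    rw [mul_comm]
    exact ((div_lt_iff₀ hε).1 ((le_max_right _ _).trans_lt hm)).le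
  have happly : ∀ x y, ((m : ℝ)⁻¹ • ∑ k ∈ Finset.range m, V k) x y =
      (m : ℝ)⁻¹ * ∑ k ∈ Finset.range m, V k x y := fun x y => by simp
  refine ⟨(m : ℝ)⁻¹ • ∑ k ∈ Finset.range m, V k, fun x y => ?_, fun x => ⟨?_, ?_⟩, fun z => ?_⟩
  · simp only [happly, hV _ x]
  · rw [happly, le_inv_mul_iff₀ hmpos, ← nsmul_eq_mul]
    simpa using Finset.card_nsmul_le_sum (Finset.range m) _ _ fun k _ => (hbounds k x).1
  · rw [happly, inv_mul_le_iff₀ hmpos, ← nsmul_eq_mul]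
    simpa using Finset.sum_le_card_nsmul (Finset.range m) _ _ fun k _ => (hbounds k x).2
  · have hshift := Finset.sum_range_succ (fun k => V k (φ z) (φ z)) m
    have hsum : ∑ k ∈ Finset.range m, V (k + 1) (φ z) (φ z) ≤
        ∑ k ∈ Finset.range m, V k z.1 z.1 + m * q z := by
      simpa [Finset.sum_add_distrib] using
        Finset.sum_le_sum fun k (_ : k ∈ Finset.range m) => hstep k z
    rw [Finset.sum_range_succ'] at hshift
    have hfirst : V 0 (φ z) (φ z) ≤ ε * m * ‖φ z‖ ^ 2 := (hbounds 0 _).2.trans (by gcongr)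
    have hlast : 0 ≤ V m (φ z) (φ z) := le_trans (by positivity) (hbounds m _).1
    rw [happly, happly, ← mul_sub, inv_mul_le_iff₀ hmpos]
    linarith

variable {X U : Type*} [NormedAddCommGroup X] [InnerProductSpace ℝ X] [FiniteDimensional ℝ X]
  [NormedAddCommGroup U] [NormedSpace ℝ U] [CompleteSpace U] {A π : X →L[ℝ] X} {B : U →L[ℝ] X}
  {Q : X × U →L[ℝ] X × U →L[ℝ] ℝ}

theorem IsEnergyBounded.norm_linFlow_le {c κ : ℝ} (hbound : IsEnergyBounded A B Q c κ)
    (hc : 0 < c) (hκ : 0 ≤ κ) (hQ : ∀ x, Q (x, 0) (x, 0) ≤ 0) (t : ℝ) (ht : 0 ≤ t) :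
    ‖linFlow A t‖ ≤ √(κ / c) := by
  refine ContinuousLinearMap.opNorm_le_bound _ (by positivity) fun x => ?_
  have h := hbound t ht 1 x _ _ (Reach.single x 0)
  rw [sampledFlow_zero_input] at h
  have hle : ‖linFlow A t x‖ ^ 2 ≤ κ / c * ‖x‖ ^ 2 := by
    rw [div_mul_eq_mul_div, le_div_iff₀' hc]
    linarith [gramian_inputGen_zero_input_nonpos (A := A) (B := B) hQ ht x]
  rw [← Real.sqrt_sq (norm_nonneg x), ← Real.sqrt_mul (by positivity)]
  exact Real.le_sqrt_of_sq_le hle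

theorem IsEnergyBounded.exists_coercive_storage_of_steering {D : X →L[ℝ] U}
    {c κ : ℝ} (hbound : IsEnergyBounded A B Q c κ) (hc : 0 ≤ c) (hκ : 0 ≤ κ)
    (hπ : IsCenterProjection A π) (hD : ∀ x, B (D x) = x - π x)
    (hQ : ∀ x, Q (x, 0) (x, 0) ≤ 0) :
    ∃ P, IsStorageForm A B Q P ∧ ∀ x, c * ‖x‖ ^ 2 ≤ P x x := by
  obtain ⟨τ, hτ, M, C, hsteer⟩ := hπ.exists_sampledReach_le hD hQ
  let h : ℕ → ℝ := fun n => τ / (n + 1)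
  have hpos : ∀ n, 0 < h n := fun n => by positivity
  have hzero : Tendsto h atTop (𝓝 0) := by
    simpa only [mul_one_div, mul_zero] using tendsto_one_div_add_atTop_nhds_zero_nat.const_mul τ
  have hup : ∀ n k x, ∃ x₀ a, SampledReach A B Q (h n) (k + (n + 1)) x₀ x a ∧
      κ * ‖x₀‖ ^ 2 + a ≤ (κ * M ^ 2 + |C|) * ‖x‖ ^ 2 := fun n k x => by
    obtain ⟨x₀, a, hR, hx₀, ha⟩ := hsteer n k x
    refine ⟨x₀, a, hR, ?_⟩
    have hx₀ : κ * ‖x₀‖ ^ 2 ≤ κ * (M * ‖x‖) ^ 2 := by gcongr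
    have ha' : C * ‖x‖ ^ 2 ≤ |C| * ‖x‖ ^ 2 := by gcongr; exact le_abs_self C
    linarith [mul_pow M ‖x‖ 2]
  have hsampled : ∀ n, ∃ P : X →L[ℝ] X →L[ℝ] ℝ, (∀ x y, P x y = P y x) ∧
      (∀ x, c * ‖x‖ ^ 2 ≤ P x x ∧ P x x ≤ (κ * M ^ 2 + |C|) * ‖x‖ ^ 2) ∧
      ∀ z, P (sampledFlow A B (h n) z) (sampledFlow A B (h n) z) - P z.1 z.1 ≤
        gramian (inputGen A B) Q (h n) z z + h n ^ 2 * ‖sampledFlow A B (h n) z‖ ^ 2 := fun n => by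
    obtain ⟨V, hV, hbounds, hstep⟩ :=
      exists_discrete_required_supply hc (by positivity) (hbound _ (hpos n).le) (hup n)
    exact exists_average_dissipation hV hc hbounds hstep (pow_pos (hpos n) 2)
  choose P hP hbounds hdiss using hsampled
  obtain ⟨P₀, hP₀, hb⟩ := exists_isStorageForm_of_sampled hpos hzero hP hc
    (fun n x => (hbounds n x).1) (fun n x => (hbounds n x).2) hdiss
  exact ⟨P₀, hP₀, fun x => (hb x).1⟩

theorem IsEnergyBounded.exists_coercive_storage {c κ : ℝ} (hbound : IsEnergyBounded A B Q c κ)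
    (hc : 0 < c) (hκ : 0 ≤ κ) (hQ : ∀ x, Q (x, 0) (x, 0) ≤ 0) :
    ∃ P, IsStorageForm A B Q P ∧ ∀ x, c / 4 * ‖x‖ ^ 2 ≤ P x x := by
  obtain ⟨π, hπ⟩ := exists_isCenterProjection (hbound.norm_linFlow_le hc hκ hQ)
  obtain ⟨P, hP, hPb⟩ := hbound.exists_available_storage hQ hc.le
  obtain ⟨Γ, g, hΓ_low, hΓ⟩ := hπ.exists_isCompensator hP (K := κ + c / 2) (by positivity)
  have hbound' := hΓ.isEnergyBounded hπ hP.symm hc.le hbound (fun x => (hPb x).1)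
    (fun x => (hPb x).2) hΓ_low
  obtain ⟨P', hP', hlow⟩ := hbound'.exists_coercive_storage_of_steering (by positivity) hκ hπ
    (D := .inr ℝ U X) (fun x => by simp) fun x => by
      rw [← Prod.mk_zero_zero, disturbedSupply_apply]
      simpa using hQ x
  exact ⟨P', hP'.of_disturbed, hlow⟩

end CoerciveStorage

section Scaling

open Filter Topology

theorem exists_le_sub_of_normalized {X : Type*} [NormedAddCommGroup X] [NormedSpace ℝ X]
    [FiniteDimensional ℝ X] {V : X → ℝ} (hcont : Continuous V) (hV0 : V 0 = 0)
    (hpos : ∀ x ≠ 0, 0 < V x) :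
    ∃ c > 0, ∃ δ > 0, ∀ x y, ‖x‖ ≤ δ → ‖y‖ ≤ 1 → (‖x‖ = δ ∨ ‖y‖ = 1) →
      c * ‖y‖ ^ 2 - 2 * c / δ ^ 2 * ‖x‖ ^ 2 ≤ V y - V x := by
  have hnonneg : ∀ x, 0 ≤ V x := fun x =>
    (eq_or_ne x 0).elim (fun hx => hx ▸ hV0.ge) fun hx => (hpos x hx).le
  obtain ⟨c, hc, hlow⟩ := exists_pos_le_on_sphere hcont hpos
  have hsmall : ∀ᶠ x in 𝓝 (0 : X), V x < c / 2 :=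
    (hcont.tendsto 0).eventually_lt_const (by rw [hV0]; positivity)
  obtain ⟨δ, hδ, hball⟩ := Metric.nhds_basis_closedBall.eventually_iff.1 hsmall
  refine ⟨c / 2, by positivity, δ, hδ, fun x y hx hy hxy => ?_⟩
  have hVx := hball (mem_closedBall_zero_iff.2 hx)
  rcases hxy with hx | hy
  · have hy' : c / 2 * ‖y‖ ^ 2 ≤ c / 2 * 1 ^ 2 := by gcongr
    rw [hx, div_mul_cancel₀ _ (by positivity)]
    linarith [hnonneg y]
  · have : 0 ≤ 2 * (c / 2) / δ ^ 2 * ‖x‖ ^ 2 := by positivity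
    rw [hy]
    linarith [hlow y hy]

theorem exists_scaled_le_sub {X : Type*} [NormedAddCommGroup X] [NormedSpace ℝ X]
    [FiniteDimensional ℝ X] {V : X → ℝ} (hcont : Continuous V) (hV0 : V 0 = 0)
    (hpos : ∀ x ≠ 0, 0 < V x) :
    ∃ c > 0, ∃ κ ≥ 0, ∀ x y, ∃ l > 0,
      l ^ 2 * (c * ‖y‖ ^ 2 - κ * ‖x‖ ^ 2) ≤ V (l • y) - V (l • x) := by
  obtain ⟨c, hc, δ, hδ, hnormalized⟩ := exists_le_sub_of_normalized hcont hV0 hpos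
  refine ⟨c, hc, 2 * c / δ ^ 2, by positivity, fun x y => ?_⟩
  rcases (le_max_of_le_right (norm_nonneg y) : 0 ≤ max (‖x‖ / δ) ‖y‖).eq_or_lt with hr | hr
  · obtain ⟨hx, hy⟩ := max_le_iff.1 hr.ge
    rw [div_le_iff₀ hδ, zero_mul, norm_le_zero_iff] at hx
    exact ⟨1, one_pos, by simp [hx, norm_le_zero_iff.1 hy]⟩
  set r := max (‖x‖ / δ) ‖y‖
  have hnorm : ∀ w : X, ‖r⁻¹ • w‖ = ‖w‖ / r := fun w => by
    rw [norm_smul, norm_inv, Real.norm_of_nonneg hr.le, inv_mul_eq_div]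
  have hscaled := hnormalized (r⁻¹ • x) (r⁻¹ • y)
    (by rw [hnorm, div_le_iff₀ hr, mul_comm, ← div_le_iff₀ hδ]; exact le_max_left _ _)
    (by rw [hnorm, div_le_one hr]; exact le_max_right _ _)
    (by
      rw [hnorm, hnorm, div_eq_iff hr.ne', mul_comm, ← div_eq_iff hδ.ne', div_eq_one_iff_eq hr.ne']
      exact (max_choice _ _).imp Eq.symm Eq.symm)
  refine ⟨r⁻¹, inv_pos.2 hr, le_trans (le_of_eq ?_) hscaled⟩
  rw [hnorm, hnorm]
  ring

theorem exists_isEnergyBounded_of_storage {X U : Type*} [NormedAddCommGroup X] [NormedSpace ℝ X]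
    [FiniteDimensional ℝ X] [NormedAddCommGroup U] [NormedSpace ℝ U] {A : X →L[ℝ] X}
    {B : U →L[ℝ] X} {Q : X × U →L[ℝ] X × U →L[ℝ] ℝ} {V : X → ℝ} (hcont : Continuous V)
    (hV0 : V 0 = 0) (hpos : ∀ x ≠ 0, 0 < V x)
    (hV : ∀ h, 0 ≤ h → ∀ z,
      V (sampledFlow A B h z) - V z.1 ≤ gramian (inputGen A B) Q h z z) :
    ∃ c > 0, ∃ κ ≥ 0, IsEnergyBounded A B Q c κ := by
  obtain ⟨c, hc, κ, hκ, hscaled⟩ := exists_scaled_le_sub hcont hV0 hpos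
  refine ⟨c, hc, κ, hκ, fun h hh N x y a hR => ?_⟩
  obtain ⟨l, hl, hle⟩ := hscaled x y
  exact le_of_mul_le_mul_left (hle.trans ((hR.smul l).sub_le (hV h hh))) (by positivity)

end Scaling

section QuadraticStorage

variable {X U : Type*} [NormedAddCommGroup X] [NormedAddCommGroup U] [NormedSpace ℝ U]
  [CompleteSpace U]

theorem exists_pos_isStorageForm_of_innerProductSpace [InnerProductSpace ℝ X]
    [FiniteDimensional ℝ X] {A : X →L[ℝ] X} {B : U →L[ℝ] X} {Q : X × U →L[ℝ] X × U →L[ℝ] ℝ}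
    (hQ : ∀ x, Q (x, 0) (x, 0) ≤ 0) {V : X → ℝ} (hcont : Continuous V) (hV0 : V 0 = 0)
    (hpos : ∀ x ≠ 0, 0 < V x)
    (hV : ∀ x u, (∀ t, HasDerivAt x (A (x t) + B u) t) → ∀ h, 0 ≤ h →
      V (x h) - V (x 0) ≤ ∫ t in (0 : ℝ)..h, Q (x t, u) (x t, u)) :
    ∃ P, IsStorageForm A B Q P ∧ ∀ x ≠ 0, 0 < P x x := by
  obtain ⟨c, hc, κ, hκ, hbound⟩ := exists_isEnergyBounded_of_storage (A := A) (B := B) (Q := Q)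
    hcont hV0 hpos fun h hh z => by
      have := hV _ z.2 (hasDerivAt_sampledFlow z) h hh
      simpa only [gramian_apply, linFlow_inputGen, sampledFlow_zero] using this
  obtain ⟨P, hP, hlow⟩ := hbound.exists_coercive_storage hc hκ hQ
  refine ⟨P, hP, fun x hx => lt_of_lt_of_le ?_ (hlow x)⟩
  have := norm_pos_iff.2 hx
  positivity

theorem exists_pos_isStorageForm [NormedSpace ℝ X] [FiniteDimensional ℝ X] {A : X →L[ℝ] X}
    {B : U →L[ℝ] X} {Q : X × U →L[ℝ] X × U →L[ℝ] ℝ} (hQ : ∀ x, Q (x, 0) (x, 0) ≤ 0) {V : X → ℝ}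
    (hcont : Continuous V) (hV0 : V 0 = 0) (hpos : ∀ x ≠ 0, 0 < V x)
    (hV : ∀ x u, (∀ t, HasDerivAt x (A (x t) + B u) t) → ∀ h, 0 ≤ h →
      V (x h) - V (x 0) ≤ ∫ t in (0 : ℝ)..h, Q (x t, u) (x t, u)) :
    ∃ P, IsStorageForm A B Q P ∧ ∀ x ≠ 0, 0 < P x x := by
  let e := toEuclidean (E := X)
  let s := e.symm.toContinuousLinearMap
  obtain ⟨P, hP, hpos'⟩ := exists_pos_isStorageForm_of_innerProductSpace (V := V ∘ e.symm)
    (A := e.toContinuousLinearMap.comp (A.comp s)) (B := e.toContinuousLinearMap.comp B)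
    (Q := Q.bilinearComp (s.prodMap (.id ℝ U)) (s.prodMap (.id ℝ U)))
    (fun x => hQ (e.symm x)) (hcont.comp e.symm.continuous) (by simpa using hV0)
    (fun x hx => hpos _ (by simpa using hx)) fun x u hx h hh =>
      hV (fun t => e.symm (x t)) u (fun t =>
        (s.hasFDerivAt.comp_hasDerivAt t (hx t)).congr_deriv (by simp [s])) h hh
  refine ⟨P.bilinearComp e.toContinuousLinearMap e.toContinuousLinearMap,
    ⟨fun x y => hP.symm _ _, fun x u => ?_⟩, fun x hx => hpos' _ (by simpa using hx)⟩
  simpa [s] using hP.dissipation (e x) u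

end QuadraticStorage

section Primitive

open Filter Topology

theorem absolutelyContinuousOnInterval_of_dist_le {X Y : Type*} [PseudoMetricSpace X]
    [PseudoMetricSpace Y] {f : ℝ → X} {g : ℝ → Y} {a b K : ℝ}
    (hg : AbsolutelyContinuousOnInterval g a b)
    (hle : ∀ s ∈ Set.uIcc a b, ∀ t ∈ Set.uIcc a b, dist (f s) (f t) ≤ K * dist (g s) (g t)) :
    AbsolutelyContinuousOnInterval f a b := by
  unfold AbsolutelyContinuousOnInterval at hg ⊢
  refine squeeze_zero' (.of_forall fun E => Finset.sum_nonneg fun i _ => dist_nonneg) ?_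
    (by simpa using hg.const_mul K)
  refine mem_inf_of_right fun E hE => ?_
  rw [Set.mem_ofPred_eq, Finset.mul_sum]
  exact Finset.sum_le_sum fun i hi => hle _ (hE.1 i hi).1 _ (hE.1 i hi).2

variable {X : Type*} [NormedAddCommGroup X] [NormedSpace ℝ X] {P : X →L[ℝ] X →L[ℝ] ℝ}
  {f : ℝ → X} {a b : ℝ}

theorem norm_form_apply_self_sub_le (P : X →L[ℝ] X →L[ℝ] ℝ) (x y : X) :
    ‖P x x - P y y‖ ≤ ‖P‖ * (‖x‖ + ‖y‖) * ‖x - y‖ := by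
  have hsplit : P x x - P y y = P x (x - y) + P (x - y) y := by
    simp only [map_sub, sub_apply]
    ring
  calc ‖P x x - P y y‖ ≤ ‖P x (x - y)‖ + ‖P (x - y) y‖ := hsplit ▸ norm_add_le _ _
    _ ≤ ‖P‖ * ‖x‖ * ‖x - y‖ + ‖P‖ * ‖x - y‖ * ‖y‖ :=
      add_le_add (P.le_opNorm₂ _ _) (P.le_opNorm₂ _ _)
    _ = ‖P‖ * (‖x‖ + ‖y‖) * ‖x - y‖ := by ring

theorem absolutelyContinuousOnInterval_form_primitive (P : X →L[ℝ] X →L[ℝ] ℝ)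
    (hf : IntervalIntegrable f volume a b) (x₀ : X) :
    AbsolutelyContinuousOnInterval
      (fun t => P (x₀ + ∫ s in a..t, f s) (x₀ + ∫ s in a..t, f s)) a b := by
  set x : ℝ → X := fun t => x₀ + ∫ s in a..t, f s
  have hx : ContinuousOn x (Set.uIcc a b) :=
    continuousOn_const.add (intervalIntegral.continuousOn_primitive_interval' hf Set.left_mem_uIcc)
  obtain ⟨M, hM⟩ := isCompact_uIcc.exists_bound_of_continuousOn hx
  refine absolutelyContinuousOnInterval_of_dist_le (K := ‖P‖ * (M + M))
    (hf.norm.absolutelyContinuousOnInterval_intervalIntegral Set.left_mem_uIcc)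
    fun s hs t ht => ?_
  have hfs := hf.mono_set (Set.uIcc_subset_uIcc_left hs)
  have hft := hf.mono_set (Set.uIcc_subset_uIcc_left ht)
  have hxst : ‖x s - x t‖ ≤ |(∫ r in a..s, ‖f r‖) - ∫ r in a..t, ‖f r‖| := by
    rw [add_sub_add_left_eq_sub, intervalIntegral.integral_interval_sub_left hfs hft,
      intervalIntegral.integral_interval_sub_left hfs.norm hft.norm]
    exact intervalIntegral.norm_integral_le_abs_integral_norm
  calc dist (P (x s) (x s)) (P (x t) (x t))
      ≤ ‖P‖ * (‖x s‖ + ‖x t‖) * ‖x s - x t‖ := norm_form_apply_self_sub_le P _ _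
    _ ≤ ‖P‖ * (M + M) * dist (∫ r in a..s, ‖f r‖) (∫ r in a..t, ‖f r‖) := by
      have hM₀ : 0 ≤ M := (norm_nonneg _).trans (hM s hs)
      gcongr
      exacts [hM s hs, hM t ht, hxst]

theorem form_sub_le_integral [CompleteSpace X] (hP : ∀ x y, P x y = P y x) (hab : a ≤ b)
    (hf : IntervalIntegrable f volume a b) {x : ℝ → X}
    (hx : ∀ t ∈ Set.Icc a b, x t = x a + ∫ s in a..t, f s) {g : ℝ → ℝ}
    (hg : IntervalIntegrable g volume a b) (hle : ∀ t, 2 * P (x t) (f t) ≤ g t) :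
    P (x b) (x b) - P (x a) (x a) ≤ ∫ t in a..b, g t := by
  set φ : ℝ → ℝ := fun t => P (x a + ∫ s in a..t, f s) (x a + ∫ s in a..t, f s)
  have hφ : AbsolutelyContinuousOnInterval φ a b :=
    absolutelyContinuousOnInterval_form_primitive P hf (x a)
  have hφx : ∀ t ∈ Set.Icc a b, φ t = P (x t) (x t) := fun t ht => by rw [hx t ht]
  rw [← hφx b (Set.right_mem_Icc.2 hab), ← hφx a (Set.left_mem_Icc.2 hab),
    ← hφ.integral_deriv_eq_sub]
  refine intervalIntegral.integral_mono_ae_restrict hab hφ.intervalIntegrable_deriv hg ?_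
  rw [EventuallyLE, ae_restrict_iff' measurableSet_Icc]
  filter_upwards [hf.ae_hasDerivAt_integral] with t hderiv ht
  rw [Set.uIcc_of_le hab] at hderiv
  have hxt := (hderiv ht a (Set.left_mem_Icc.2 hab)).const_add (x a)
  rw [(hasDerivAt_form_apply_self hP hxt).deriv, ← hx t ht]
  exact hle t

end Primitive

section

open Matrix

section MatrixForm

variable {ι κ : Type*} [Fintype ι] [Fintype κ] [DecidableEq ι] [DecidableEq κ]

/-- The continuous bilinear form `(x, y) ↦ xᵀ M y`. -/
noncomputable def matrixForm (M : Matrix ι κ ℝ) : (ι → ℝ) →L[ℝ] (κ → ℝ) →L[ℝ] ℝ :=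
  (Matrix.toLinearMap₂' ℝ M).toContinuousBilinearMap

theorem matrixForm_apply (M : Matrix ι κ ℝ) (x : ι → ℝ) (y : κ → ℝ) :
    matrixForm M x y = x ⬝ᵥ M *ᵥ y :=
  Matrix.toLinearMap₂'_apply' M x y

theorem exists_matrixForm_eq (P : (ι → ℝ) →L[ℝ] (κ → ℝ) →L[ℝ] ℝ) : ∃ M, matrixForm M = P := by
  refine ⟨LinearMap.toMatrix₂' ℝ P.toLinearMap₁₂, ?_⟩
  ext x y
  simp [matrixForm]

theorem matrixForm_comm_iff {M : Matrix ι ι ℝ} :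
    (∀ x y, matrixForm M x y = matrixForm M y x) ↔ M.IsSymm := by
  constructor
  · intro h
    ext i j
    simpa [matrixForm_apply] using h (Pi.single j 1) (Pi.single i 1)
  · intro h x y
    rw [matrixForm_apply, matrixForm_apply, ← dotProduct_transpose_mulVec, h.eq]

end MatrixForm

namespace CTLTISystem

variable {n p m : ℕ}

/-- The pointwise form of the dissipation inequality for the storage function `xᵀ P x`. -/
def IsStorageMatrix (sys : CTLTISystem n p m) (Q : Matrix (Fin m) (Fin m) ℝ)
    (S : Matrix (Fin m) (Fin p) ℝ) (R : Matrix (Fin p) (Fin p) ℝ) (P : Matrix (Fin n) (Fin n) ℝ) :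
    Prop :=
  ∀ x u, 2 * (x ⬝ᵥ P *ᵥ (sys.A *ᵥ x + sys.B *ᵥ u)) ≤
    supplyRate Q S R (sys.C *ᵥ x + sys.D *ᵥ u) u

/-- The supply rate as a bilinear form in the pair of state and input. -/
noncomputable def supplyForm (sys : CTLTISystem n p m) (Q : Matrix (Fin m) (Fin m) ℝ)
    (S : Matrix (Fin m) (Fin p) ℝ) (R : Matrix (Fin p) (Fin p) ℝ) :
    (Fin n → ℝ) × (Fin p → ℝ) →L[ℝ] (Fin n → ℝ) × (Fin p → ℝ) →L[ℝ] ℝ :=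
  let outputInput := ((LinearEquiv.sumArrowLequivProdArrow (Fin m) (Fin p) ℝ ℝ).symm.toLinearMap ∘ₗ
    (sys.C.mulVecLin.coprod sys.D.mulVecLin).prod (.snd ℝ _ _)).toContinuousLinearMap
  (matrixForm (fromBlocks Q S Sᵀ R)).bilinearComp outputInput outputInput

theorem supplyForm_apply (sys : CTLTISystem n p m) (Q : Matrix (Fin m) (Fin m) ℝ)
    (S : Matrix (Fin m) (Fin p) ℝ) (R : Matrix (Fin p) (Fin p) ℝ) (x : Fin n → ℝ)
    (u : Fin p → ℝ) :
    sys.supplyForm Q S R (x, u) (x, u) = supplyRate Q S R (sys.C *ᵥ x + sys.D *ᵥ u) u :=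
  matrixForm_apply (fromBlocks Q S Sᵀ R) _ _

variable {sys : CTLTISystem n p m} {x : ℝ → Fin n → ℝ} {u : ℝ → Fin p → ℝ}

theorem IsTrajectory.of_hasDerivAt {u : Fin p → ℝ}
    (h : ∀ t, HasDerivAt x (sys.A *ᵥ x t + sys.B *ᵥ u) t) : sys.IsTrajectory x fun _ => u := by
  have hx : Continuous x := continuous_iff_continuousAt.2 fun t => (h t).continuousAt
  refine ⟨fun T => memLp_const u, hx.continuousOn, fun t _ => ?_⟩
  have hx' : Continuous fun t => sys.A *ᵥ x t + sys.B *ᵥ u := by fun_prop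
  rw [intervalIntegral.integral_eq_sub_of_hasDerivAt (fun s _ => h s) (hx'.intervalIntegrable 0 t),
    add_sub_cancel]

theorem IsTrajectory.memLp_prodMk (h : sys.IsTrajectory x u) (T : ℝ) :
    MemLp (fun t => (x t, u t)) 2 (volume.restrict (Set.Icc 0 T)) := by
  have hx : ContinuousOn x (Set.Icc 0 T) := h.state_continuousOn.mono fun t ht => ht.1
  obtain ⟨M, hM⟩ := isCompact_Icc.exists_bound_of_continuousOn hx
  have hx₂ : MemLp x 2 (volume.restrict (Set.Icc 0 T)) :=
    .of_bound (hx.aestronglyMeasurable measurableSet_Icc) M <|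
      (ae_restrict_iff' measurableSet_Icc).2 (.of_forall hM)
  have hsum := ((ContinuousLinearMap.inl ℝ (Fin n → ℝ) (Fin p → ℝ)).comp_memLp' hx₂).add
    ((ContinuousLinearMap.inr ℝ (Fin n → ℝ) (Fin p → ℝ)).comp_memLp' (h.input_memLp T))
  refine hsum.ae_eq (.of_forall fun t => ?_)
  simp

theorem IsTrajectory.intervalIntegrable_rhs (h : sys.IsTrajectory x u) {t₀ t₁ : ℝ} (h₀ : 0 ≤ t₀)
    (h₁ : 0 ≤ t₁) : IntervalIntegrable (fun t => sys.A *ᵥ x t + sys.B *ᵥ u t) volume t₀ t₁ := by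
  have hT : ∀ T, 0 ≤ T → IntervalIntegrable (fun t => sys.A *ᵥ x t + sys.B *ᵥ u t) volume 0 T := by
    intro T hT
    rw [intervalIntegrable_iff_integrableOn_Icc_of_le hT]
    exact ((sys.A.mulVecLin.coprod sys.B.mulVecLin).toContinuousLinearMap.comp_memLp'
      (h.memLp_prodMk T)).integrable one_le_two
  exact (hT t₀ h₀).symm.trans (hT t₁ h₁)

theorem IsTrajectory.intervalIntegrable_supplyRate (h : sys.IsTrajectory x u)
    (Q : Matrix (Fin m) (Fin m) ℝ) (S : Matrix (Fin m) (Fin p) ℝ) (R : Matrix (Fin p) (Fin p) ℝ)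
    {t₀ t₁ : ℝ} (h₀ : 0 ≤ t₀) (h₁ : t₀ ≤ t₁) :
    IntervalIntegrable (fun t => supplyRate Q S R (sys.output x u t) (u t)) volume t₀ t₁ := by
  rw [intervalIntegrable_iff_integrableOn_Icc_of_le h₁]
  refine IntegrableOn.mono_set ?_ (Set.Icc_subset_Icc_left h₀)
  refine memLp_one_iff_integrable.1 (((sys.supplyForm Q S R).memLp_of_bilin 1 (h.memLp_prodMk t₁)
    (h.memLp_prodMk t₁)).ae_eq (.of_forall fun t => ?_))
  exact sys.supplyForm_apply Q S R (x t) (u t)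

theorem IsTrajectory.state_eq_add (h : sys.IsTrajectory x u) {t₀ t : ℝ} (h₀ : 0 ≤ t₀)
    (ht : 0 ≤ t) : x t = x t₀ + ∫ s in t₀..t, (sys.A *ᵥ x s + sys.B *ᵥ u s) := by
  rw [h.state_eq t ht, h.state_eq t₀ h₀, add_assoc, intervalIntegral.integral_add_adjacent_intervals
    (h.intervalIntegrable_rhs le_rfl h₀) (h.intervalIntegrable_rhs h₀ ht)]

variable {Q : Matrix (Fin m) (Fin m) ℝ} {S : Matrix (Fin m) (Fin p) ℝ}
  {R : Matrix (Fin p) (Fin p) ℝ} {P : Matrix (Fin n) (Fin n) ℝ}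

theorem IsStorageMatrix.sub_le_integral (hdiss : sys.IsStorageMatrix Q S R P) (hP : P.IsSymm)
    (h : sys.IsTrajectory x u) {t₀ t₁ : ℝ} (h₀ : 0 ≤ t₀) (h₁ : t₀ ≤ t₁) :
    x t₁ ⬝ᵥ P *ᵥ x t₁ - x t₀ ⬝ᵥ P *ᵥ x t₀ ≤
      ∫ t in t₀..t₁, supplyRate Q S R (sys.output x u t) (u t) := by
  simp only [← matrixForm_apply]
  refine form_sub_le_integral (matrixForm_comm_iff.2 hP) h₁
    (h.intervalIntegrable_rhs h₀ (h₀.trans h₁))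
    (fun t ht => h.state_eq_add h₀ (h₀.trans ht.1))
    (h.intervalIntegrable_supplyRate Q S R h₀ h₁) fun t => ?_
  rw [matrixForm_apply]
  exact hdiss (x t) (u t)

theorem IsStorageMatrix.isDissipative (hdiss : sys.IsStorageMatrix Q S R P) (hP : P.PosDef) :
    sys.IsDissipative Q S R := by
  refine ⟨fun x => x ⬝ᵥ P *ᵥ x, ⟨by fun_prop, by simp, fun x hx => ?_⟩,
    fun x u h t₀ t₁ => hdiss.sub_le_integral ?_ h⟩
  · simpa using hP.dotProduct_mulVec_pos hx
  · rw [IsSymm, ← conjTranspose_eq_transpose_of_trivial, hP.1]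

theorem supplyForm_state_nonpos (sys : CTLTISystem n p m) (hQ : (-Q).PosSemidef)
    (S : Matrix (Fin m) (Fin p) ℝ) (R : Matrix (Fin p) (Fin p) ℝ) (x : Fin n → ℝ) :
    sys.supplyForm Q S R (x, 0) (x, 0) ≤ 0 := by
  have hneg := hQ.dotProduct_mulVec_nonneg (sys.C *ᵥ x)
  rw [star_trivial, neg_mulVec, dotProduct_neg, neg_nonneg] at hneg
  simpa [supplyForm_apply, supplyRate, fromBlocks_mulVec] using hneg

theorem IsDissipative.exists_isStorageMatrix (h : sys.IsDissipative Q S R) (hQ : (-Q).PosSemidef) :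
    ∃ P : Matrix (Fin n) (Fin n) ℝ, P.PosDef ∧ sys.IsStorageMatrix Q S R P := by
  obtain ⟨V, hV, hdiss⟩ := h
  obtain ⟨P, hP, hpos⟩ := exists_pos_isStorageForm (V := V)
    (A := sys.A.mulVecLin.toContinuousLinearMap) (B := sys.B.mulVecLin.toContinuousLinearMap)
    (sys.supplyForm_state_nonpos hQ S R) hV.continuous hV.map_zero hV.pos fun x u hx h hh => by
      simpa only [supplyForm_apply, output] using hdiss x _ (.of_hasDerivAt hx) 0 h le_rfl hh
  obtain ⟨M, rfl⟩ := exists_matrixForm_eq P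
  refine ⟨M, .of_dotProduct_mulVec_pos ?_ fun x hx => ?_, fun x u => ?_⟩
  · rw [IsHermitian, conjTranspose_eq_transpose_of_trivial]
    exact matrixForm_comm_iff.1 hP.symm
  · rw [star_trivial, ← matrixForm_apply]
    exact hpos x hx
  · rw [← matrixForm_apply, ← supplyForm_apply]
    exact hP.dissipation x u

end CTLTISystem

section LMI

theorem dotProduct_transpose_mul_mulVec {ι κ l : Type*} [Fintype ι] [Fintype κ] [Fintype l]
    (M : Matrix ι κ ℝ) (N : Matrix ι l ℝ) (x : κ → ℝ) (y : l → ℝ) :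
    x ⬝ᵥ (Mᵀ * N) *ᵥ y = (M *ᵥ x) ⬝ᵥ (N *ᵥ y) := by
  rw [← mulVec_mulVec, dotProduct_transpose_mulVec, dotProduct_comm]

theorem posSemidef_fromBlocks_neg_inv_iff {ι κ : Type*} [Finite ι] [Fintype κ] [DecidableEq κ]
    {Q : Matrix κ κ ℝ} (hQ : (-Q).PosDef) (M : Matrix ι ι ℝ) (N : Matrix κ ι ℝ) :
    (fromBlocks M Nᵀ N (-Q⁻¹)).PosSemidef ↔ (M + Nᵀ * Q * N).PosSemidef := by
  have hdet : IsUnit Q.det := (isUnit_iff_isUnit_det Q).1 (IsUnit.neg_iff Q |>.1 hQ.isUnit)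
  have hinv : (-Q)⁻¹ = -Q⁻¹ := inv_eq_right_inv (by rw [neg_mul_neg, mul_nonsing_inv _ hdet])
  have hinv' : (-Q⁻¹)⁻¹ = -Q := inv_eq_right_inv (by rw [neg_mul_neg, nonsing_inv_mul _ hdet])
  have hpos : (-Q⁻¹).PosDef := hinv ▸ hQ.inv
  let _ : Invertible (-Q⁻¹) := hpos.isUnit.invertible
  have hschur := PosDef.fromBlocks₂₂ M Nᵀ hpos
  rwa [conjTranspose_eq_transpose_of_trivial, transpose_transpose, hinv', Matrix.mul_neg,
    Matrix.neg_mul, sub_neg_eq_add] at hschur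

end LMI

namespace CTLTISystem

variable {n p m : ℕ}

theorem supplyRate_eq (Q : Matrix (Fin m) (Fin m) ℝ) (S : Matrix (Fin m) (Fin p) ℝ)
    (R : Matrix (Fin p) (Fin p) ℝ) (y : Fin m → ℝ) (u : Fin p → ℝ) :
    supplyRate Q S R y u = y ⬝ᵥ Q *ᵥ y + 2 * (y ⬝ᵥ S *ᵥ u) + u ⬝ᵥ R *ᵥ u := by
  rw [supplyRate, fromBlocks_mulVec, sumElim_dotProduct_sumElim]
  simp only [Sum.elim_comp_inl, Sum.elim_comp_inr, dotProduct_add, dotProduct_transpose_mulVec]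
  ring

/-- The part of the linear matrix inequality that does not involve `Q`: the matrix of the quadratic
form `2 yᵀ S u + uᵀ R u - 2 xᵀ P (A x + B u)` in `(x, u)`, where `y = C x + D u`. -/
noncomputable def crossMatrix (sys : CTLTISystem n p m) (S : Matrix (Fin m) (Fin p) ℝ)
    (R : Matrix (Fin p) (Fin p) ℝ) (P : Matrix (Fin n) (Fin n) ℝ) :
    Matrix (Fin n ⊕ Fin p) (Fin n ⊕ Fin p) ℝ :=
  fromBlocks (-symPart (P * sys.A)) (-(P * sys.B) + sys.Cᵀ * S)
    (-(P * sys.B) + sys.Cᵀ * S)ᵀ (symPart (sys.Dᵀ * S) + R)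

theorem isHermitian_crossMatrix (sys : CTLTISystem n p m) (S : Matrix (Fin m) (Fin p) ℝ)
    {R : Matrix (Fin p) (Fin p) ℝ} (hR : R.IsSymm) (P : Matrix (Fin n) (Fin n) ℝ) :
    (sys.crossMatrix S R P).IsHermitian := by
  refine IsHermitian.fromBlocks ?_ (conjTranspose_eq_transpose_of_trivial _) ?_
  · simp [IsHermitian, conjTranspose_eq_transpose_of_trivial, symPart, add_comm]
  · simp [IsHermitian, conjTranspose_eq_transpose_of_trivial, symPart, add_comm, hR.eq]

theorem dotProduct_crossMatrix_mulVec (sys : CTLTISystem n p m) (S : Matrix (Fin m) (Fin p) ℝ)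
    (R : Matrix (Fin p) (Fin p) ℝ) (P : Matrix (Fin n) (Fin n) ℝ) (x : Fin n → ℝ)
    (u : Fin p → ℝ) :
    Sum.elim x u ⬝ᵥ sys.crossMatrix S R P *ᵥ Sum.elim x u =
      2 * ((sys.C *ᵥ x + sys.D *ᵥ u) ⬝ᵥ S *ᵥ u) + u ⬝ᵥ R *ᵥ u -
        2 * (x ⬝ᵥ P *ᵥ (sys.A *ᵥ x + sys.B *ᵥ u)) := by
  rw [crossMatrix, fromBlocks_mulVec, sumElim_dotProduct_sumElim]
  simp only [Sum.elim_comp_inl, Sum.elim_comp_inr, dotProduct_add, dotProduct_transpose_mulVec,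
    symPart, add_mulVec, neg_mulVec, dotProduct_neg, mulVec_add, dotProduct_transpose_mul_mulVec,
    add_dotProduct, mulVec_mulVec]
  ring

theorem posSemidef_crossMatrix_add_iff (sys : CTLTISystem n p m) {Q : Matrix (Fin m) (Fin m) ℝ}
    (hQ : Q.IsHermitian) (S : Matrix (Fin m) (Fin p) ℝ) {R : Matrix (Fin p) (Fin p) ℝ}
    (hR : R.IsSymm) (P : Matrix (Fin n) (Fin n) ℝ) :
    (sys.crossMatrix S R P + (fromCols sys.C sys.D)ᵀ * Q * fromCols sys.C sys.D).PosSemidef ↔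
      sys.IsStorageMatrix Q S R P := by
  have hquad (x : Fin n → ℝ) (u : Fin p → ℝ) : Sum.elim x u ⬝ᵥ
      (sys.crossMatrix S R P + (fromCols sys.C sys.D)ᵀ * Q * fromCols sys.C sys.D) *ᵥ
        Sum.elim x u =
      supplyRate Q S R (sys.C *ᵥ x + sys.D *ᵥ u) u -
        2 * (x ⬝ᵥ P *ᵥ (sys.A *ᵥ x + sys.B *ᵥ u)) := by
    rw [add_mulVec, dotProduct_add, dotProduct_crossMatrix_mulVec, Matrix.mul_assoc,
      dotProduct_transpose_mul_mulVec, ← mulVec_mulVec, fromCols_mulVec, Sum.elim_comp_inl,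
      Sum.elim_comp_inr, supplyRate_eq]
    ring
  constructor
  · intro h x u
    have hnonneg := h.dotProduct_mulVec_nonneg (Sum.elim x u)
    rwa [star_trivial, hquad, sub_nonneg] at hnonneg
  · intro h
    refine .of_dotProduct_mulVec_nonneg ((sys.isHermitian_crossMatrix S hR P).add ?_) fun v => ?_
    · rw [← conjTranspose_eq_transpose_of_trivial]
      exact isHermitian_conjTranspose_mul_mul _ hQ
    · rw [star_trivial, ← Sum.elim_comp_inl_inr v, hquad, sub_nonneg]
      exact h _ _

end CTLTISystem

section Observer

variable {n m q l : ℕ} (A : Matrix (Fin n) (Fin n) ℝ) (C : Matrix (Fin m) (Fin n) ℝ)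
  (E : Matrix (Fin n) (Fin q) ℝ) (F : Matrix (Fin m) (Fin q) ℝ) (G : Matrix (Fin l) (Fin n) ℝ)
  (J : Matrix (Fin l) (Fin q) ℝ) (L : Matrix (Fin n) (Fin m) ℝ)

theorem dissipativeObserverLMI_eq_fromBlocks (Q : Matrix (Fin l) (Fin l) ℝ)
    (S : Matrix (Fin l) (Fin q) ℝ) (R : Matrix (Fin q) (Fin q) ℝ) (P : Matrix (Fin n) (Fin n) ℝ) :
    dissipativeObserverLMI A C E F G J Q S R P (P * L) =
      fromBlocks ((luenbergerErrorSystem A C E F G J L).crossMatrix S R P) (fromCols G J)ᵀ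
        (fromCols G J) (-Q⁻¹) := by
  simp only [dissipativeObserverLMI, CTLTISystem.crossMatrix, luenbergerErrorSystem, Matrix.mul_sub,
    Matrix.mul_assoc, neg_sub, transpose_fromCols, neg_add_eq_sub]

theorem posSemidef_dissipativeObserverLMI_iff {Q : Matrix (Fin l) (Fin l) ℝ} (hQ : (-Q).PosDef)
    (S : Matrix (Fin l) (Fin q) ℝ) {R : Matrix (Fin q) (Fin q) ℝ} (hR : R.IsSymm)
    (P : Matrix (Fin n) (Fin n) ℝ) :
    (dissipativeObserverLMI A C E F G J Q S R P (P * L)).PosSemidef ↔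
      (luenbergerErrorSystem A C E F G J L).IsStorageMatrix Q S R P := by
  have hQ' : Q.IsHermitian := by simpa only [neg_neg] using hQ.1.neg
  rw [dissipativeObserverLMI_eq_fromBlocks, posSemidef_fromBlocks_neg_inv_iff hQ]
  exact CTLTISystem.posSemidef_crossMatrix_add_iff _ hQ' S hR P

end Observer

end

theorem mainTheorem4 {n m q l : ℕ}
    (A : Matrix (Fin n) (Fin n) ℝ) (C : Matrix (Fin m) (Fin n) ℝ)
    (E : Matrix (Fin n) (Fin q) ℝ) (F : Matrix (Fin m) (Fin q) ℝ)
    (G : Matrix (Fin l) (Fin n) ℝ) (J : Matrix (Fin l) (Fin q) ℝ)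
    (L : Matrix (Fin n) (Fin m) ℝ)
    (Q : Matrix (Fin l) (Fin l) ℝ) (S : Matrix (Fin l) (Fin q) ℝ)
    (R : Matrix (Fin q) (Fin q) ℝ)
    (hQ : (-Q).PosDef) (hR : R.IsSymm) :
    (luenbergerErrorSystem A C E F G J L).IsDissipative Q S R ↔
      ∃ (P : Matrix (Fin n) (Fin n) ℝ) (K : Matrix (Fin n) (Fin m) ℝ),
        P.PosDef ∧
        (dissipativeObserverLMI A C E F G J Q S R P K).PosSemidef ∧
        L = P⁻¹ * K := by
  have hLMI := fun L => posSemidef_dissipativeObserverLMI_iff A C E F G J L hQ S hR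
  constructor
  · intro h
    obtain ⟨P, hP, hstorage⟩ := h.exists_isStorageMatrix hQ.posSemidef
    refine ⟨P, P * L, hP, (hLMI L P).2 hstorage, ?_⟩
    rw [Matrix.nonsing_inv_mul_cancel_left _ _ ((Matrix.isUnit_iff_isUnit_det P).1 hP.isUnit)]
  · rintro ⟨P, K, hP, hPSD, rfl⟩
    refine CTLTISystem.IsStorageMatrix.isDissipative ((hLMI (P⁻¹ * K) P).1 ?_) hP
    rwa [Matrix.mul_nonsing_inv_cancel_left _ _ ((Matrix.isUnit_iff_isUnit_det P).1 hP.isUnit)]
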